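/- Let $H$ be a real separable Hilbert space and let $\Psi$ be a bounded linear operator on $H$ with $\|\Psi\|_{\mathcal L}<1$; all random elements are defined on one probability space $(\Omega,\mathcal A,P)$. For $x,y\in H$ let $(x\otimes y)(v)=\langle x,v\rangle y$. Elements $X,Y\in L^2_H$ are orthogonal, $X\perp Y$, if $E[X\otimes Y]=0$; an $H$-white noise is a sequence of pairwise orthogonal elements of $L^2_H$ with constant mean and constant covariance operator $E[(X-EX)\otimes(X-EX)]$. A sequence $(X_n)_{n\ge1}$ in $L^4_H$ is $L^4$-$m$-approximable if $X_n=f(\delta_n,\delta_{n-1},\dots)$ a.s. for all $n\ge 1$, with i.i.d. $(\delta_i)_{i\in\mathbb Z}$ in a measurable space $S$ and a measurable $f:S^\infty\to H$, and $\sum_{m\ge1}\bigl(E\|X_m-X_m^{(m)}\|^4\bigr)^{1/4}<\infty$, where $X_m^{(m)}=f(\delta_m,\dots,\delta_1,\delta_0',\delta_{-1}',\dots)$ and $(\delta'_i)$ is an independent copy of $(\delta_i)$. Consider the recursion $X_{n+1}=\Psi(X_n)+\varepsilon_{n+1}$ a.s. It is the linear model $Y_k=\Psi(X_k)+\eta_k$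 with responses $Y_k=X_{k+1}$ and errors $\eta_k=\varepsilon_{k+1}$, $k\ge 1$. Assumption (A) says: $(X_k)_{k\ge1}$ and $(\eta_k)_{k\ge1}$ have mean zero and are $L^4$-$m$-approximable, $(\eta_k)_{k\ge1}$ is $H$-white noise, and $X_k\perp\eta_k$ for all $k\ge1$. (1) Let $(X_n)_{n\ge1}$ satisfy the recursion for all $n\ge1$ and let Assumption (A) hold. Let $m_n\to\infty$ be real numbers with $m_n=o(\sqrt n)$. Put $\hat C_n=\frac1n\sum_{k=1}^nX_k\otimes X_k$ and $\hat\Delta_n=\frac1n\sum_{k=1}^nX_k\otimes X_{k+1}$, let $\hat\lambda_1\ge\hat\lambda_2\ge\dots\ge0$ be the eigenvalues of $\hat C_n$ with multiplicity and $\hat v_1,\hat v_2,\dots$ corresponding orthonormal eigenvectors, and let $K_n=\max\{j\ge1:\hat\lambda_1/\hat\lambda_j\le m_n\}$, where a quotient with $\hat\lambda_j=0$ counts as $\infty$ and $K_n=0$ if there is no such $j$. Then, for any choice of the eigenvectors, the estimator $$\hat\Psi_{K_n}(x)=\sum_{j=1}^{K_n}\frac{\hat\Delta_n(\hat v_j)}{\hat\lambda_j}\langle\hat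 v_j,x\rangle$$ satisfies $\|\Psi(X_n)-\hat\Psi_{K_n}(X_n)\|\to0$ in probability as $n\to\infty$. (2) Let $(X_n)_{n\in\mathbb Z}$ be a strictly stationary process satisfying the recursion for all $n\in\mathbb Z$, where $(\varepsilon_i)_{i\in\mathbb Z}$ are i.i.d. in $L^4_H$ with mean zero. Then Assumption (A) holds. -/

import Mathlib

open MeasureTheory ProbabilityTheory Filter Topology

universe u

noncomputable section

namespace FunctionalRegression

section Operators

variable {H₁ H₂ : Type*} [NormedAddCommGroup H₁] [InnerProductSpace ℝ H₁]
  [NormedAddCommGroup H₂] [InnerProductSpace ℝ H₂]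

/-- The operator `x ⊗ y : H₁ → H₂`, `(x ⊗ y)(v) = ⟨x, v⟩ y`. -/
def tensor (x : H₁) (y : H₂) : H₁ →L[ℝ] H₂ := InnerProductSpace.rankOne ℝ y x

theorem tensor_apply (x v : H₁) (y : H₂) : tensor x y v = inner ℝ x v • y := rfl

end Operators

section Probability

variable {Ω : Type*} [MeasurableSpace Ω]

/-- The elements `X` and `Y` of `L²` are orthogonal: `E[X ⊗ Y] = 0`. -/
def Orthogonal {H₁ H₂ : Type*} [NormedAddCommGroup H₁] [InnerProductSpace ℝ H₁]
    [NormedAddCommGroup H₂] [InnerProductSpace ℝ H₂]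
    (P : Measure Ω) (X : Ω → H₁) (Y : Ω → H₂) : Prop :=
  MemLp X 2 P ∧ MemLp Y 2 P ∧ ∫ ω, tensor (X ω) (Y ω) ∂P = 0

/-- The covariance operator `E[(X - EX) ⊗ (X - EX)]`. -/
def covOperator {H : Type*} [NormedAddCommGroup H] [InnerProductSpace ℝ H]
    (P : Measure Ω) (X : Ω → H) : H →L[ℝ] H :=
  ∫ ω, tensor (X ω - ∫ ω', X ω' ∂P) (X ω - ∫ ω', X ω' ∂P) ∂P

/-- `(ε k)`, `k ≥ 1`, is an `H`-white noise: square integrable, pairwise orthogonal, with constant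
mean and constant covariance operator. -/
structure IsWhiteNoise {H : Type*} [NormedAddCommGroup H] [InnerProductSpace ℝ H]
    (P : Measure Ω) (ε : ℕ → Ω → H) : Prop where
  memLp : ∀ k, 1 ≤ k → MemLp (ε k) 2 P
  orthogonal : ∀ j k, 1 ≤ j → 1 ≤ k → j ≠ k → Orthogonal P (ε j) (ε k)
  mean_const : ∀ j k, 1 ≤ j → 1 ≤ k → ∫ ω, ε j ω ∂P = ∫ ω, ε k ω ∂P
  cov_const : ∀ j k, 1 ≤ j → 1 ≤ k → covOperator P (ε j) = covOperator P (ε k)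

/-- The number `ν_p(X_m - X_m^{(m)})` for `X_m = f(δ_m, δ_{m-1}, …)`, where
`X_m^{(m)} = f(δ_m, …, δ_1, δ'_0, δ'_{-1}, …)`. The independent copy `δ'` of `δ` is realized on the
product space: `δ` is read off the first coordinate and `δ'` off the second one. -/
def couplingError {S H : Type*} [NormedAddCommGroup H]
    (P : Measure Ω) (p : ENNReal) (δ : ℤ → Ω → S) (f : (ℕ → S) → H) (m : ℕ) : ENNReal :=
  eLpNorm (fun q : Ω × Ω =>
    f (fun j : ℕ => δ ((m : ℤ) - j) q.1) -
      f (fun j : ℕ => if j < m then δ ((m : ℤ) - j) q.1 else δ ((m : ℤ) - j) q.2)) p (P.prod P)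

/-- `L^p`-`m`-approximability of the sequence `(X n)`, `n ≥ 1`: the `X n` have `p` moments,
`X n = f(δ_n, δ_{n-1}, …)` almost surely with `f` measurable and `(δ_i)` i.i.d., and
`∑_{m ≥ 1} ν_p(X_m - X_m^{(m)}) < ∞`. -/
def IsLpMApproximable {H : Type u} [NormedAddCommGroup H] [MeasurableSpace H]
    (P : Measure Ω) (p : ENNReal) (X : ℕ → Ω → H) : Prop :=
  (∀ n, 1 ≤ n → MemLp (X n) p P) ∧
  ∃ (S : Type u) (_ : MeasurableSpace S) (δ : ℤ → Ω → S) (f : (ℕ → S) → H),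
    (∀ i, Measurable (δ i)) ∧ iIndepFun δ P ∧ (∀ i, IdentDistrib (δ i) (δ 0) P P) ∧
    Measurable f ∧
    (∀ n : ℕ, 1 ≤ n → X n =ᵐ[P] fun ω => f (fun j : ℕ => δ ((n : ℤ) - j) ω)) ∧
    ∑' m : ℕ, couplingError P p δ f (m + 1) ≠ ⊤

/-- Assumption (A) on the regressors `X k` and the errors `ε k`, `k ≥ 1`, of the linear model
`Y k = Ψ (X k) + ε k` with `Ψ : H₁ →L[ℝ] H₂`. -/
structure AssumptionA {H₁ H₂ : Type*} [NormedAddCommGroup H₁] [InnerProductSpace ℝ H₁]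
    [MeasurableSpace H₁] [NormedAddCommGroup H₂] [InnerProductSpace ℝ H₂] [MeasurableSpace H₂]
    (P : Measure Ω) (X : ℕ → Ω → H₁) (ε : ℕ → Ω → H₂) : Prop where
  mean_X : ∀ k, 1 ≤ k → ∫ ω, X k ω ∂P = 0
  mean_ε : ∀ k, 1 ≤ k → ∫ ω, ε k ω ∂P = 0
  approx_X : IsLpMApproximable P 4 X
  approx_ε : IsLpMApproximable P 4 ε
  whiteNoise : IsWhiteNoise P ε
  orthogonal : ∀ k, 1 ≤ k → Orthogonal P (X k) (ε k)

/-- A (two-sided) stationary ARH(1) process with operator `Ψ` and innovations `ε`. -/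
structure IsStationaryARH1 {H : Type*} [NormedAddCommGroup H] [InnerProductSpace ℝ H]
    [MeasurableSpace H] (P : Measure Ω) (Ψ : H →L[ℝ] H) (X ε : ℤ → Ω → H) : Prop where
  aemeasurable : ∀ k, AEMeasurable (X k) P
  stationary : ∀ h : ℤ, P.map (fun ω k => X (k + h) ω) = P.map (fun ω k => X k ω)
  recurrence : ∀ k, ∀ᵐ ω ∂P, X (k + 1) ω = Ψ (X k ω) + ε (k + 1) ω

end Probability

section Estimator

variable {H₁ H₂ : Type*} [NormedAddCommGroup H₁] [InnerProductSpace ℝ H₁]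
  [NormedAddCommGroup H₂] [InnerProductSpace ℝ H₂]

/-- The empirical operator `(1/n) ∑_{k=1}^n x_k ⊗ y_k`. For `y = x` it is `Ĉ_n`, and for the
responses `y` it is `Δ̂_n`. -/
def empiricalOperator (n : ℕ) (x : ℕ → H₁) (y : ℕ → H₂) : H₁ →L[ℝ] H₂ :=
  (n : ℝ)⁻¹ • ∑ k ∈ Finset.Icc 1 n, tensor (x k) (y k)

/-- `(lam j, v j)`, `j ≥ 1`, are the eigenvalues, in decreasing order and with multiplicity, and
orthonormal eigenvectors of the positive operator `T`: `T = ∑_j lam_j v_j ⊗ v_j`.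
The `v j` with `lam j = 0` play no role and are left free. -/
structure IsEigensystem (T : H₁ →L[ℝ] H₁) (lam : ℕ → ℝ) (v : ℕ → H₁) : Prop where
  nonneg : ∀ j, 1 ≤ j → 0 ≤ lam j
  antitone : ∀ i j, 1 ≤ i → i ≤ j → lam j ≤ lam i
  orthonormal : Orthonormal ℝ (fun j : {j : ℕ // 1 ≤ j ∧ lam j ≠ 0} => v j)
  hasSum : ∀ x, HasSum (fun j : ℕ => lam (j + 1) • tensor (v (j + 1)) (v (j + 1)) x) (T x)

/-- `K_n = argmax {j ≥ 1 | λ̂_1 / λ̂_j ≤ m_n}`, where a quotient with `λ̂_j = 0` counts as `∞`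
(so `j ≤ n`, since `Ĉ_n` has rank at most `n`). It is `0` if there is no such `j`. -/
def truncationLevel (n : ℕ) (mn : ℝ) (lam : ℕ → ℝ) : ℕ :=
  sSup {j : ℕ | 1 ≤ j ∧ j ≤ n ∧ 0 < lam j ∧ lam 1 / lam j ≤ mn}

/-- The principal component estimator `Ψ̂_K(z) = ∑_{j=1}^K (⟨v̂_j, z⟩ / λ̂_j) Δ̂_n(v̂_j)` computed
from the sample `(x_k, y_k)`, `1 ≤ k ≤ n`, and an eigensystem `(lam, v)` of `Ĉ_n`. -/
def pcEstimator (n K : ℕ) (x : ℕ → H₁) (y : ℕ → H₂) (lam : ℕ → ℝ) (v : ℕ → H₁) (z : H₁) : H₂ :=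
  ∑ j ∈ Finset.Icc 1 K, (inner ℝ (v j) z / lam j) • empiricalOperator n x y (v j)

end Estimator

end FunctionalRegression

end

/-!
Write `Δ` for the empirical operator of the pairs `(X_k, ε_{k+1})` and `Π` for the projection on the
first `K_n` empirical eigenvectors. The prediction error splits as
`Ψ (X_n - Π X_n) - Δ (∑_{j ≤ K_n} ⟨v̂_j, X_n⟩ / λ̂_j v̂_j)`.

The first term needs no consistency of eigenvectors and no spectral gap. Almost surely `X_n` lies in
the closed range of `C = E[X ⊗ X]`, so up to a small probability it is close to `C d` for one of
finitely many `d`. There `C d` is close to `Ĉ_n d` in mean square, and `Ĉ_n d` is at distance at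
most `λ̂_1 ‖d‖ / m_n` from the range of `Π`, because `λ̂_j ≤ λ̂_1 / m_n` for `j > K_n`.

In the second term the regularized inverse has norm at most `m_n / λ̂_1`, while `‖Δ‖` is of order
`n^{-1/2}` in mean square: the coupling bounds the covariances of the centred sequence
`X_k ⊗ ε_{k+1}`, measured in the Hilbert–Schmidt norm, by a summable sequence.

For the second claim, two solutions of the recursion with the same innovations differ at time `k` by
`Ψ^n` applied to their difference at time `k - n`, which vanishes in probability. So `X_k` is the
causal series `∑_j Ψ^j ε_{k-j}`, whose coupling error at `m` is at most a constant times `‖Ψ^m‖`.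
-/

noncomputable section

namespace FunctionalRegression

section Past

variable {Ω S : Type*}

/-- The past `(δ_k, δ_{k-1}, …)` of a sequence. -/
def past (δ : ℤ → Ω → S) (k : ℤ) (ω : Ω) : ℕ → S := fun j => δ (k - j) ω

/-- The sequence `(δ_m, …, δ_1, δ'_0, δ'_{-1}, …)`, where `δ` is read off the first coordinate and
its independent copy `δ'` off the second one, as in `couplingError`. -/
def coupledPast (δ : ℤ → Ω → S) (m : ℕ) (q : Ω × Ω) : ℕ → S :=
  fun j => if j < m then δ ((m : ℤ) - j) q.1 else δ ((m : ℤ) - j) q.2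

/-- Two independent copies of a family of random elements, as one family on the product space. -/
def twoCopies {ι : Type*} (δ : ι → Ω → S) : ι ⊕ ι → Ω × Ω → S :=
  Sum.elim (fun i q => δ i q.1) (fun i q => δ i q.2)

/-- The indices in `twoCopies δ` of the entries of `coupledPast δ m`. -/
def coupledIndex (m j : ℕ) : ℤ ⊕ ℤ :=
  if j < m then .inl ((m : ℤ) - j) else .inr ((m : ℤ) - j)

theorem coupledIndex_injective (m : ℕ) : (coupledIndex m).Injective := by
  intro a b hab
  grind [coupledIndex]

theorem coupledPast_eq (δ : ℤ → Ω → S) (m : ℕ) :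
    coupledPast δ m = fun q j => twoCopies δ (coupledIndex m j) q := by
  funext q j
  simp only [coupledPast, coupledIndex]
  split_ifs <;> rfl

theorem past_tail (δ : ℤ → Ω → S) (k : ℤ) (j : ℕ) (ω : Ω) :
    (fun i => past δ (k + j) ω (i + j)) = past δ k ω := by
  funext i
  simp [past]

theorem coupledPast_tail (δ : ℤ → Ω → S) (m : ℕ) (q : Ω × Ω) :
    (fun i => coupledPast δ (m + 1) q (i + 1)) = coupledPast δ m q := by
  funext i
  simp [coupledPast]

theorem comap_reindex_le [MeasurableSpace S] {ι κ : Type*} (X : ι → Ω → S) (φ : κ → ι) :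
    MeasurableSpace.comap (fun ω i => X (φ i) ω) MeasurableSpace.pi ≤
      ⨆ i ∈ Set.range φ, MeasurableSpace.comap (X i) inferInstance := by
  rw [MeasurableSpace.pi, MeasurableSpace.comap_iSup]
  refine iSup_le fun i => ?_
  rw [MeasurableSpace.comap_comp]
  exact le_iSup₂_of_le (φ i) ⟨i, rfl⟩ le_rfl

end Past

section IID

variable {Ω Ω' S : Type*} [MeasurableSpace Ω] [MeasurableSpace Ω'] [MeasurableSpace S]
  {P : Measure Ω}

theorem iIndepFun_sumElim_prod {ι κ : Type*} {Q : Measure Ω'} [IsProbabilityMeasure P]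
    [IsProbabilityMeasure Q] {X : ι → Ω → S} {Y : κ → Ω' → S} (hX : iIndepFun X P)
    (hY : iIndepFun Y Q) :
    iIndepFun (Sum.elim (fun i (q : Ω × Ω') => X i q.1) (fun j q => Y j q.2)) (P.prod Q) := by
  set Z := Sum.elim (fun i (q : Ω × Ω') => X i q.1) (fun j q => Y j q.2)
  rw [iIndepFun_iff_measure_inter_preimage_eq_mul]
  intro s A hA
  have hinter : ⋂ i ∈ s, Z i ⁻¹' A i =
      (⋂ i ∈ s.toLeft, X i ⁻¹' A (.inl i)) ×ˢ (⋂ j ∈ s.toRight, Y j ⁻¹' A (.inr j)) := by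
    ext q
    simp [Z, Sum.forall]
  have hleft (i : ι) : (P.prod Q) (Z (.inl i) ⁻¹' A (.inl i)) = P (X i ⁻¹' A (.inl i)) := by
    change (P.prod Q) (Prod.fst ⁻¹' (X i ⁻¹' A (.inl i))) = _
    rw [← Set.prod_univ, Measure.prod_prod, measure_univ, mul_one]
  have hright (j : κ) : (P.prod Q) (Z (.inr j) ⁻¹' A (.inr j)) = Q (Y j ⁻¹' A (.inr j)) := by
    change (P.prod Q) (Prod.snd ⁻¹' (Y j ⁻¹' A (.inr j))) = _
    rw [← Set.univ_prod, Measure.prod_prod, measure_univ, one_mul]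
  rw [hinter, Measure.prod_prod, ← Finset.toLeft_disjSum_toRight (u := s), Finset.prod_disjSum]
  simp only [hleft, hright, Finset.toLeft_disjSum, Finset.toRight_disjSum]
  rw [hX.measure_inter_preimage_eq_mul _ fun i hi => hA _ (by simpa using hi),
    hY.measure_inter_preimage_eq_mul _ fun j hj => hA _ (by simpa using hj)]

theorem indepFun_reindex {ι κ κ' : Type*} {X : ι → Ω → S} (hX : iIndepFun X P)
    (hm : ∀ i, Measurable (X i)) {φ : κ → ι} {ψ : κ' → ι}
    (hφψ : Disjoint (Set.range φ) (Set.range ψ)) :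
    IndepFun (fun ω i => X (φ i) ω) (fun ω j => X (ψ j) ω) P :=
  (IndepFun_iff_Indep _ _ _).2 <| indep_of_indep_of_le_left (indep_of_indep_of_le_right
    (indep_iSup_of_disjoint (fun i => (hm i).comap_le) hX.iIndep hφψ) (comap_reindex_le X ψ))
    (comap_reindex_le X φ)

/-- An i.i.d. family of random elements. -/
structure IsIID {ι : Type*} (P : Measure Ω) (δ : ι → Ω → S) : Prop where
  measurable : ∀ i, Measurable (δ i)
  indep : iIndepFun δ P
  identDistrib : ∀ i j, IdentDistrib (δ i) (δ j) P P

theorem IsIID.identDistrib_reindex {ι κ : Type*} {δ : ι → Ω → S} (h : IsIID P δ) {φ ψ : κ → ι}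
    (hφ : φ.Injective) (hψ : ψ.Injective) :
    IdentDistrib (fun ω i => δ (φ i) ω) (fun ω i => δ (ψ i) ω) P P where
  aemeasurable_fst := (measurable_pi_lambda _ fun i => h.measurable (φ i)).aemeasurable
  aemeasurable_snd := (measurable_pi_lambda _ fun i => h.measurable (ψ i)).aemeasurable
  map_eq := by
    rw [(h.indep.precomp hφ).map_fun_eq_infinitePi_map fun i => h.measurable (φ i),
      (h.indep.precomp hψ).map_fun_eq_infinitePi_map fun i => h.measurable (ψ i)]
    exact congrArg _ (funext fun i => (h.identDistrib (φ i) (ψ i)).map_eq)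

theorem identDistrib_fst {X : Ω → S} [IsProbabilityMeasure P] (hX : Measurable X) :
    IdentDistrib (fun q : Ω × Ω => X q.1) X (P.prod P) P where
  aemeasurable_fst := (hX.comp measurable_fst).aemeasurable
  aemeasurable_snd := hX.aemeasurable
  map_eq := by
    change (P.prod P).map (X ∘ Prod.fst) = _
    rw [← Measure.map_map hX measurable_fst, Measure.map_fst_prod]
    simp

theorem identDistrib_snd {X : Ω → S} [IsProbabilityMeasure P] (hX : Measurable X) :
    IdentDistrib (fun q : Ω × Ω => X q.2) X (P.prod P) P where
  aemeasurable_fst := (hX.comp measurable_snd).aemeasurable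
  aemeasurable_snd := hX.aemeasurable
  map_eq := by
    change (P.prod P).map (X ∘ Prod.snd) = _
    rw [← Measure.map_map hX measurable_snd, Measure.map_snd_prod]
    simp

theorem IsIID.twoCopies {ι : Type*} {δ : ι → Ω → S} [IsProbabilityMeasure P] (h : IsIID P δ) :
    IsIID (P.prod P) (twoCopies δ) where
  measurable
    | .inl i => (h.measurable i).comp measurable_fst
    | .inr i => (h.measurable i).comp measurable_snd
  indep := iIndepFun_sumElim_prod h.indep h.indep
  identDistrib i j := by
    have toBase (i : ι ⊕ ι) : ∃ k, IdentDistrib (FunctionalRegression.twoCopies δ i) (δ k)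
        (P.prod P) P := by
      rcases i with i | i
      · exact ⟨i, identDistrib_fst (h.measurable i)⟩
      · exact ⟨i, identDistrib_snd (h.measurable i)⟩
    obtain ⟨k, hk⟩ := toBase i
    obtain ⟨l, hl⟩ := toBase j
    exact (hk.trans (h.identDistrib k l)).trans hl.symm

namespace IsIID

variable {δ : ℤ → Ω → S}

theorem measurable_past (h : IsIID P δ) (k : ℤ) : Measurable (past δ k) :=
  measurable_pi_lambda _ fun _ => h.measurable _

theorem identDistrib_past (h : IsIID P δ) (k l : ℤ) :
    IdentDistrib (past δ k) (past δ l) P P :=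
  h.identDistrib_reindex (fun a b hab => by simpa using hab) (fun a b hab => by simpa using hab)

theorem indepFun_past_succ (h : IsIID P δ) (k : ℤ) : IndepFun (past δ k) (δ (k + 1)) P := by
  have hdisj : Disjoint (Set.range fun j : ℕ => k - j) (Set.range fun _ : Unit => k + 1) := by
    simp only [Set.range_const, Set.disjoint_singleton_right, Set.mem_range, not_exists]
    omega
  exact (indepFun_reindex h.indep h.measurable hdisj).comp measurable_id (measurable_pi_apply ())

variable [IsProbabilityMeasure P]

theorem measurable_coupledPast (h : IsIID P δ) (m : ℕ) : Measurable (coupledPast δ m) := by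
  rw [coupledPast_eq]
  exact measurable_pi_lambda _ fun _ => h.twoCopies.measurable _

theorem identDistrib_coupledPast (h : IsIID P δ) (m : ℕ) (k : ℤ) :
    IdentDistrib (coupledPast δ m) (past δ k) (P.prod P) P := by
  rw [coupledPast_eq]
  exact (h.twoCopies.identDistrib_reindex (coupledIndex_injective m)
    (ψ := fun j : ℕ => .inl (k - (j : ℤ))) (fun a b hab => by simpa using hab)).trans
    (identDistrib_fst (h.measurable_past k))

theorem indepFun_past_coupledPast (h : IsIID P δ) (m : ℕ) :
    IndepFun (fun q => past δ 0 q.1) (coupledPast δ m) (P.prod P) := by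
  have hdisj : Disjoint (Set.range fun j : ℕ => (Sum.inl (0 - (j : ℤ)) : ℤ ⊕ ℤ))
      (Set.range (coupledIndex m)) := by
    refine Set.disjoint_range_iff.2 fun i j => ?_
    grind [coupledIndex]
  rw [coupledPast_eq]
  exact indepFun_reindex h.twoCopies.indep h.twoCopies.measurable hdisj

end IsIID

end IID

section IdenticalDistribution

variable {Ω Ω' S E : Type*} [MeasurableSpace Ω] [MeasurableSpace Ω'] [MeasurableSpace S]
  {P : Measure Ω} {Q : Measure Ω'} {U : Ω → S} {V : Ω' → S} {f : S → E}

theorem eLpNorm_comp_eq_of_identDistrib [NormedAddCommGroup E] (h : IdentDistrib U V P Q)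
    (hf : StronglyMeasurable f) (p : ENNReal) :
    eLpNorm (fun ω => f (U ω)) p P = eLpNorm (fun ω => f (V ω)) p Q := by
  have hU := eLpNorm_map_measure (p := p) hf.aestronglyMeasurable h.aemeasurable_fst
  have hV := eLpNorm_map_measure (p := p) hf.aestronglyMeasurable h.aemeasurable_snd
  exact hU.symm.trans ((congrArg _ h.map_eq).trans hV)

theorem memLp_comp_iff_of_identDistrib [NormedAddCommGroup E] (h : IdentDistrib U V P Q)
    (hf : StronglyMeasurable f) {p : ENNReal} :
    MemLp (fun ω => f (U ω)) p P ↔ MemLp (fun ω => f (V ω)) p Q := by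
  have hU := memLp_map_measure_iff (p := p) hf.aestronglyMeasurable h.aemeasurable_fst
  have hV := memLp_map_measure_iff (p := p) hf.aestronglyMeasurable h.aemeasurable_snd
  rw [h.map_eq] at hU
  exact hU.symm.trans hV

theorem integral_comp_eq_of_identDistrib [NormedAddCommGroup E] [NormedSpace ℝ E]
    (h : IdentDistrib U V P Q) (hf : StronglyMeasurable f) :
    ∫ ω, f (U ω) ∂P = ∫ ω, f (V ω) ∂Q := by
  rw [← integral_map h.aemeasurable_fst hf.aestronglyMeasurable, h.map_eq,
    integral_map h.aemeasurable_snd hf.aestronglyMeasurable]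

end IdenticalDistribution

section Coupling

variable {Ω S : Type*} [MeasurableSpace Ω] {P : Measure Ω} {δ : ℤ → Ω → S}
  {E E₁ E₂ : Type*} [NormedAddCommGroup E] [NormedAddCommGroup E₁] [NormedAddCommGroup E₂]
  {f g : (ℕ → S) → E} {p q r : ENNReal}

theorem eLpNorm_clm_le [NormedSpace ℝ E] [NormedSpace ℝ E₁] (A : E →L[ℝ] E₁) (f : Ω → E) :
    eLpNorm (fun ω => A (f ω)) p P ≤ ‖A‖ₑ * eLpNorm f p P :=
  eLpNorm_le_nnreal_smul_eLpNorm_of_ae_le_mul (c := ‖A‖₊)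
    (Eventually.of_forall fun ω => A.le_opNNNorm (f ω)) p

theorem couplingError_clm_le [NormedSpace ℝ E] [NormedSpace ℝ E₁] (A : E →L[ℝ] E₁) (m : ℕ) :
    couplingError P p δ (fun s => A (f s)) m ≤ ‖A‖ₑ * couplingError P p δ f m := by
  simp only [couplingError, ← map_sub]
  exact eLpNorm_clm_le A _

theorem couplingError_tail (m : ℕ) :
    couplingError P p δ (fun s => f fun i => s (i + 1)) (m + 1) = couplingError P p δ f m := by
  refine congrArg (eLpNorm · p (P.prod P)) (funext fun q => ?_)
  exact congrArg₂ (f · - f ·) (past_tail δ m 1 q.1) (coupledPast_tail δ m q)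

variable [MeasurableSpace S]

namespace IsIID

theorem memLp_past (h : IsIID P δ) (hf : StronglyMeasurable f)
    (hfp : MemLp (fun ω => f (past δ 0 ω)) p P) (k : ℤ) : MemLp (fun ω => f (past δ k ω)) p P :=
  (memLp_comp_iff_of_identDistrib (h.identDistrib_past k 0) hf).2 hfp

theorem aestronglyMeasurable_past_fst (h : IsIID P δ) (hf : StronglyMeasurable f) (k : ℤ) :
    AEStronglyMeasurable (fun q : Ω × Ω => f (past δ k q.1)) (P.prod P) :=
  (hf.comp_measurable ((h.measurable_past k).comp measurable_fst)).aestronglyMeasurable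

variable [IsProbabilityMeasure P]

theorem memLp_coupledPast (h : IsIID P δ) (hf : StronglyMeasurable f)
    (hfp : MemLp (fun ω => f (past δ 0 ω)) p P) (m : ℕ) :
    MemLp (fun q => f (coupledPast δ m q)) p (P.prod P) :=
  (memLp_comp_iff_of_identDistrib (h.identDistrib_coupledPast m 0) hf).2 hfp

theorem couplingError_ne_top (h : IsIID P δ) (hf : StronglyMeasurable f)
    (hfp : MemLp (fun ω => f (past δ 0 ω)) p P) (m : ℕ) : couplingError P p δ f m ≠ ⊤ :=
  (((h.memLp_past hf hfp m).comp_fst P).sub (h.memLp_coupledPast hf hfp m)).eLpNorm_ne_top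

theorem aestronglyMeasurable_coupledPast (h : IsIID P δ) (hf : StronglyMeasurable f) (m : ℕ) :
    AEStronglyMeasurable (fun q => f (coupledPast δ m q)) (P.prod P) :=
  (hf.comp_measurable (h.measurable_coupledPast m)).aestronglyMeasurable

theorem couplingError_sub_le (h : IsIID P δ) (hp : 1 ≤ p) (hf : StronglyMeasurable f)
    (hg : StronglyMeasurable g) (m : ℕ) :
    couplingError P p δ (fun s => f s - g s) m
      ≤ couplingError P p δ f m + couplingError P p δ g m := by
  refine le_trans (le_of_eq (congrArg (eLpNorm · p (P.prod P)) (funext fun q => ?_)))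
    (eLpNorm_sub_le
      ((h.aestronglyMeasurable_past_fst hf m).sub (h.aestronglyMeasurable_coupledPast hf m))
      ((h.aestronglyMeasurable_past_fst hg m).sub (h.aestronglyMeasurable_coupledPast hg m)) hp)
  exact sub_sub_sub_comm _ _ _ _

theorem couplingError_bilin_le [NormedSpace ℝ E] [NormedSpace ℝ E₁] [NormedSpace ℝ E₂]
    [p.HolderTriple q r] (h : IsIID P δ) (hr : 1 ≤ r) (B : E₁ →L[ℝ] E₂ →L[ℝ] E)
    {u : (ℕ → S) → E₁} {w : (ℕ → S) → E₂} (hu : StronglyMeasurable u) (hw : StronglyMeasurable w)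
    (m : ℕ) :
    couplingError P r δ (fun s => B (u s) (w s)) m
      ≤ ‖B‖ₑ * couplingError P p δ u m * eLpNorm (fun ω => w (past δ 0 ω)) q P
        + ‖B‖ₑ * eLpNorm (fun ω => u (past δ 0 ω)) p P * couplingError P q δ w m := by
  have hu₁ := h.aestronglyMeasurable_past_fst hu m
  have hu₂ := h.aestronglyMeasurable_coupledPast hu m
  have hw₁ := h.aestronglyMeasurable_past_fst hw m
  have hw₂ := h.aestronglyMeasurable_coupledPast hw m
  have hw_norm : eLpNorm (fun q : Ω × Ω => w (past δ m q.1)) q (P.prod P)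
      = eLpNorm (fun ω => w (past δ 0 ω)) q P :=
    eLpNorm_comp_eq_of_identDistrib
      ((identDistrib_fst (h.measurable_past m)).trans (h.identDistrib_past m 0)) hw q
  have hu_norm : eLpNorm (fun q => u (coupledPast δ m q)) p (P.prod P)
      = eLpNorm (fun ω => u (past δ 0 ω)) p P :=
    eLpNorm_comp_eq_of_identDistrib (h.identDistrib_coupledPast m 0) hu p
  have holder {a : Ω × Ω → E₁} {b : Ω × Ω → E₂} (ha : AEStronglyMeasurable a (P.prod P))
      (hb : AEStronglyMeasurable b (P.prod P)) :
      eLpNorm (fun q => B (a q) (b q)) r (P.prod P)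
        ≤ ‖B‖ₑ * eLpNorm a p (P.prod P) * eLpNorm b q (P.prod P) :=
    eLpNorm_le_eLpNorm_mul_eLpNorm_of_nnnorm ha hb (fun a b => B a b) ‖B‖₊
      (Eventually.of_forall fun q => by exact_mod_cast B.le_opNorm₂ _ _)
  rw [← hw_norm, ← hu_norm]
  calc couplingError P r δ (fun s => B (u s) (w s)) m
      = eLpNorm ((fun q => B (u (past δ m q.1) - u (coupledPast δ m q)) (w (past δ m q.1)))
          + fun q => B (u (coupledPast δ m q)) (w (past δ m q.1) - w (coupledPast δ m q)))
          r (P.prod P) := by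
        refine congrArg (eLpNorm · r (P.prod P)) (funext fun q => ?_)
        change B (u (past δ m q.1)) (w (past δ m q.1)) - B (u (coupledPast δ m q))
          (w (coupledPast δ m q)) = _
        simp only [Pi.add_apply, map_sub, _root_.sub_apply]
        abel
    _ ≤ _ := eLpNorm_add_le (B.aestronglyMeasurable_comp₂ (hu₁.sub hu₂) hw₁)
        (B.aestronglyMeasurable_comp₂ hu₂ (hw₁.sub hw₂)) hr
    _ ≤ _ := add_le_add (holder (hu₁.sub hu₂) hw₁) (holder hu₂ (hw₁.sub hw₂))

end IsIID

/-- The stationary sequence `f (δ_k, δ_{k-1}, …)` has `p` moments and summable coupling errors.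
The coupling error at `m = 0`, which is finite anyway, is included in the sum. -/
structure IsMApproximable (P : Measure Ω) (p : ENNReal) (δ : ℤ → Ω → S) (f : (ℕ → S) → E) :
    Prop where
  stronglyMeasurable : StronglyMeasurable f
  memLp : MemLp (fun ω => f (past δ 0 ω)) p P
  tsum_ne_top : ∑' m, couplingError P p δ f m ≠ ⊤

namespace IsMApproximable

theorem memLp_past (hf : IsMApproximable P p δ f) (h : IsIID P δ) (k : ℤ) :
    MemLp (fun ω => f (past δ k ω)) p P :=
  h.memLp_past hf.stronglyMeasurable hf.memLp k

theorem clm [NormedSpace ℝ E] [NormedSpace ℝ E₁] (hf : IsMApproximable P p δ f)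
    (A : E →L[ℝ] E₁) : IsMApproximable P p δ (fun s => A (f s)) where
  stronglyMeasurable := A.continuous.comp_stronglyMeasurable hf.stronglyMeasurable
  memLp := A.comp_memLp' hf.memLp
  tsum_ne_top := ne_top_of_le_ne_top
    (by rw [ENNReal.tsum_mul_left]; exact ENNReal.mul_ne_top enorm_ne_top hf.tsum_ne_top)
    (ENNReal.tsum_le_tsum (couplingError_clm_le A))

variable [IsProbabilityMeasure P]

theorem const (e : E) : IsMApproximable P p δ (fun _ => e) where
  stronglyMeasurable := stronglyMeasurable_const
  memLp := memLp_const e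
  tsum_ne_top := by simp [couplingError]

theorem sub (hf : IsMApproximable P p δ f) (hg : IsMApproximable P p δ g) (h : IsIID P δ)
    (hp : 1 ≤ p) : IsMApproximable P p δ (fun s => f s - g s) where
  stronglyMeasurable := hf.stronglyMeasurable.sub hg.stronglyMeasurable
  memLp := hf.memLp.sub hg.memLp
  tsum_ne_top := ne_top_of_le_ne_top
    (by rw [ENNReal.tsum_add]; exact ENNReal.add_ne_top.2 ⟨hf.tsum_ne_top, hg.tsum_ne_top⟩)
    (ENNReal.tsum_le_tsum
      (h.couplingError_sub_le hp hf.stronglyMeasurable hg.stronglyMeasurable))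

theorem tail (hf : IsMApproximable P p δ f) (h : IsIID P δ) :
    IsMApproximable P p δ (fun s => f fun i => s (i + 1)) := by
  have hmeas : StronglyMeasurable fun s : ℕ → S => f fun i => s (i + 1) :=
    hf.stronglyMeasurable.comp_measurable (by fun_prop)
  have hmem : MemLp (fun ω => f fun i => past δ 0 ω (i + 1)) p P := by
    have := hf.memLp_past h (-1)
    simpa only [← past_tail δ (-1) 1, Nat.cast_one, neg_add_cancel] using this
  refine ⟨hmeas, hmem, ?_⟩
  rw [tsum_eq_zero_add' ENNReal.summable]
  simp only [couplingError_tail]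
  exact ENNReal.add_ne_top.2 ⟨h.couplingError_ne_top hmeas hmem 0, hf.tsum_ne_top⟩

theorem bilin [NormedSpace ℝ E] [NormedSpace ℝ E₁] [NormedSpace ℝ E₂] [p.HolderTriple q r]
    {u : (ℕ → S) → E₁} {w : (ℕ → S) → E₂} (hu : IsMApproximable P p δ u)
    (hw : IsMApproximable P q δ w) (h : IsIID P δ) (hr : 1 ≤ r) (B : E₁ →L[ℝ] E₂ →L[ℝ] E) :
    IsMApproximable P r δ (fun s => B (u s) (w s)) where
  stronglyMeasurable := B.continuous₂.comp_stronglyMeasurable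
    (hu.stronglyMeasurable.prodMk hw.stronglyMeasurable)
  memLp := B.memLp_of_bilin (p := p) (q := q) r hu.memLp hw.memLp
  tsum_ne_top := by
    refine ne_top_of_le_ne_top ?_ (ENNReal.tsum_le_tsum
      (h.couplingError_bilin_le (p := p) (q := q) hr B hu.stronglyMeasurable hw.stronglyMeasurable))
    rw [ENNReal.tsum_add, ENNReal.tsum_mul_right, ENNReal.tsum_mul_left, ENNReal.tsum_mul_left]
    exact ENNReal.add_ne_top.2
      ⟨ENNReal.mul_ne_top (ENNReal.mul_ne_top enorm_ne_top hu.tsum_ne_top) hw.memLp.2.ne,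
        ENNReal.mul_ne_top (ENNReal.mul_ne_top enorm_ne_top hu.memLp.2.ne) hw.tsum_ne_top⟩

end IsMApproximable

theorem IsLpMApproximable.exists_isMApproximable [IsProbabilityMeasure P] {H : Type u}
    [NormedAddCommGroup H] [MeasurableSpace H] [OpensMeasurableSpace H] [SecondCountableTopology H]
    {X : ℕ → Ω → H} (hX : IsLpMApproximable P p X) :
    ∃ (S : Type u) (_ : MeasurableSpace S) (δ : ℤ → Ω → S) (f : (ℕ → S) → H),
      IsIID P δ ∧ IsMApproximable P p δ f ∧
        ∀ n : ℕ, 1 ≤ n → X n =ᵐ[P] fun ω => f (past δ n ω) := by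
  obtain ⟨hmem, S, _, δ, f, hδ, hindep, hident, hf, hrep, hsum⟩ := hX
  have h : IsIID P δ := ⟨hδ, hindep, fun i j => (hident i).trans (hident j).symm⟩
  have hmem₀ : MemLp (fun ω => f (past δ 0 ω)) p P :=
    (memLp_comp_iff_of_identDistrib (h.identDistrib_past 1 0) hf.stronglyMeasurable).1
      ((memLp_congr_ae (hrep 1 le_rfl)).1 (hmem 1 le_rfl))
  refine ⟨S, _, δ, f, h, ⟨hf.stronglyMeasurable, hmem₀, ?_⟩, hrep⟩
  rw [tsum_eq_zero_add' ENNReal.summable]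
  exact ENNReal.add_ne_top.2 ⟨h.couplingError_ne_top hf.stronglyMeasurable hmem₀ 0, hsum⟩

theorem IsMApproximable.isLpMApproximable {S H : Type u} [MeasurableSpace S]
    [NormedAddCommGroup H] [MeasurableSpace H] [BorelSpace H] {δ : ℤ → Ω → S} {f : (ℕ → S) → H}
    (hf : IsMApproximable P p δ f) (h : IsIID P δ) {X : ℕ → Ω → H}
    (hX : ∀ n : ℕ, 1 ≤ n → X n =ᵐ[P] fun ω => f (past δ n ω)) : IsLpMApproximable P p X :=
  ⟨fun n hn => (memLp_congr_ae (hX n hn)).2 (hf.memLp_past h n), S, _, δ, f, h.measurable, h.indep,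
    fun i => h.identDistrib i 0, hf.stronglyMeasurable.measurable, hX,
    ne_top_of_le_ne_top hf.tsum_ne_top
      (ENNReal.tsum_comp_le_tsum_of_injective (add_left_injective 1) _)⟩

end Coupling

section SecondMoments

variable {Ω : Type*} [MeasurableSpace Ω] {P : Measure Ω}
  {E : Type*} [NormedAddCommGroup E] [InnerProductSpace ℝ E]

theorem integrable_inner {X Y : Ω → E} (hX : MemLp X 2 P) (hY : MemLp Y 2 P) :
    Integrable (fun ω => inner ℝ (X ω) (Y ω)) P :=
  memLp_one_iff_integrable.1 ((innerSL ℝ).memLp_of_bilin (p := 2) (q := 2) 1 hX hY)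

theorem abs_integral_inner_le {X Y : Ω → E} (hX : MemLp X 2 P) (hY : MemLp Y 2 P) :
    |∫ ω, inner ℝ (X ω) (Y ω) ∂P| ≤ (eLpNorm X 2 P).toReal * (eLpNorm Y 2 P).toReal := by
  have hinner : ∫ ω, inner ℝ (X ω) (Y ω) ∂P = inner ℝ (hX.toLp X) (hY.toLp Y) := by
    rw [L2.inner_def]
    refine integral_congr_ae ?_
    filter_upwards [hX.coeFn_toLp, hY.coeFn_toLp] with ω hXω hYω
    rw [hXω, hYω]
  rw [hinner, ← Lp.norm_toLp X hX, ← Lp.norm_toLp Y hY]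
  exact abs_real_inner_le_norm _ _

theorem integral_inner_comp_eq_zero_of_indepFun [IsFiniteMeasure P] {S T : Type*}
    [MeasurableSpace S] [MeasurableSpace T] {U : Ω → S} {V : Ω → T} (hUV : IndepFun U V P)
    (hU : AEMeasurable U P) (hV : AEMeasurable V P) {f : S → E} {g : T → E}
    (hf : StronglyMeasurable f) (hg : StronglyMeasurable g) (hfU : MemLp (fun ω => f (U ω)) 2 P)
    (hgV : MemLp (fun ω => g (V ω)) 2 P) (hzero : ∀ e, ∫ ω, inner ℝ e (g (V ω)) ∂P = 0) :
    ∫ ω, inner ℝ (f (U ω)) (g (V ω)) ∂P = 0 := by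
  have hfg : StronglyMeasurable fun z : S × T => inner ℝ (f z.1) (g z.2) :=
    (hf.comp_measurable measurable_fst).inner (hg.comp_measurable measurable_snd)
  have hf₂ : MemLp f 2 (P.map U) := (memLp_map_measure_iff hf.aestronglyMeasurable hU).2 hfU
  have hg₂ : MemLp g 2 (P.map V) := (memLp_map_measure_iff hg.aestronglyMeasurable hV).2 hgV
  have hcentred (e : E) : ∫ t, inner ℝ e (g t) ∂(P.map V) = 0 := by
    rw [integral_map hV (stronglyMeasurable_const.inner hg).aestronglyMeasurable, hzero]
  calc ∫ ω, inner ℝ (f (U ω)) (g (V ω)) ∂P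
      = ∫ z, inner ℝ (f z.1) (g z.2) ∂((P.map U).prod (P.map V)) := by
        rw [← hUV.map_prod_eq_prod_map_map hU hV,
          integral_map (hU.prodMk hV) hfg.aestronglyMeasurable]
    _ = ∫ s, ∫ t, inner ℝ (f s) (g t) ∂(P.map V) ∂(P.map U) :=
        integral_prod _ (integrable_inner (hf₂.comp_fst _) (hg₂.comp_snd _))
    _ = 0 := by simp only [hcentred, integral_zero]

theorem integral_norm_sum_sq_le {Z : ℕ → Ω → E} {M : ℝ} {e : ℕ → ℝ}
    (hZ : ∀ k, MemLp (Z k) 2 P) (hM : ∀ k, ∫ ω, ‖Z k ω‖ ^ 2 ∂P ≤ M) (he : Summable e)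
    (hcov : ∀ k m, |∫ ω, inner ℝ (Z k ω) (Z (k + m + 1) ω) ∂P| ≤ e m) (n : ℕ) :
    ∫ ω, ‖∑ k ∈ Finset.range n, Z k ω‖ ^ 2 ∂P ≤ (M + 2 * ∑' m, e m) * n := by
  have he_nonneg (m : ℕ) : 0 ≤ e m := (abs_nonneg _).trans (hcov 0 m)
  have hsum (n : ℕ) : MemLp (fun ω => ∑ k ∈ Finset.range n, Z k ω) 2 P :=
    memLp_finsetSum _ fun k _ => hZ k
  have hcross (n : ℕ) :
      ∫ ω, inner ℝ (∑ k ∈ Finset.range n, Z k ω) (Z n ω) ∂P ≤ ∑' m, e m :=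
    calc ∫ ω, inner ℝ (∑ k ∈ Finset.range n, Z k ω) (Z n ω) ∂P
        = ∑ k ∈ Finset.range n, ∫ ω, inner ℝ (Z k ω) (Z n ω) ∂P := by
          simp only [sum_inner]
          exact integral_finsetSum _ fun k _ => integrable_inner (hZ k) (hZ n)
      _ ≤ ∑ k ∈ Finset.range n, e (n - 1 - k) := by
          refine Finset.sum_le_sum fun k hk => (le_abs_self _).trans ?_
          have hk := Finset.mem_range.1 hk
          simpa only [show k + (n - 1 - k) + 1 = n by omega] using hcov k (n - 1 - k)
      _ = ∑ k ∈ Finset.range n, e k := Finset.sum_range_reflect e n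
      _ ≤ ∑' m, e m := he.sum_le_tsum _ fun m _ => he_nonneg m
  induction n with
  | zero => simp
  | succ n ih =>
    have hsum_sq := (hsum n).integrable_norm_pow (p := 2) two_ne_zero
    have hinner := (integrable_inner (hsum n) (hZ n)).const_mul 2
    calc ∫ ω, ‖∑ k ∈ Finset.range (n + 1), Z k ω‖ ^ 2 ∂P
        = ∫ ω, ‖∑ k ∈ Finset.range n, Z k ω‖ ^ 2 ∂P
            + 2 * ∫ ω, inner ℝ (∑ k ∈ Finset.range n, Z k ω) (Z n ω) ∂P
            + ∫ ω, ‖Z n ω‖ ^ 2 ∂P := by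
          simp only [Finset.sum_range_succ, norm_add_sq_real]
          rw [integral_add (by exact hsum_sq.add hinner) ((hZ n).integrable_norm_pow two_ne_zero),
            integral_add hsum_sq hinner, integral_const_mul]
      _ ≤ (M + 2 * ∑' m, e m) * n + 2 * ∑' m, e m + M := by gcongr; exacts [hcross n, hM n]
      _ = (M + 2 * ∑' m, e m) * (n + 1 : ℕ) := by push_cast; ring

variable {S : Type*} [MeasurableSpace S] {δ : ℤ → Ω → S} {f : (ℕ → S) → E}

theorem IsIID.abs_covariance_le [IsProbabilityMeasure P] (h : IsIID P δ)
    (hf : StronglyMeasurable f) (hf₂ : MemLp (fun ω => f (past δ 0 ω)) 2 P)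
    (hzero : ∀ e, ∫ ω, inner ℝ e (f (past δ 0 ω)) ∂P = 0) (k : ℤ) (m : ℕ) :
    |∫ ω, inner ℝ (f (past δ k ω)) (f (past δ (k + m) ω)) ∂P|
      ≤ (eLpNorm (fun ω => f (past δ 0 ω)) 2 P).toReal * (couplingError P 2 δ f m).toReal := by
  have h₀ : MemLp (fun q : Ω × Ω => f (past δ 0 q.1)) 2 (P.prod P) := hf₂.comp_fst P
  have hm : MemLp (fun q : Ω × Ω => f (past δ m q.1)) 2 (P.prod P) :=
    (h.memLp_past hf hf₂ m).comp_fst P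
  have hc := h.memLp_coupledPast hf hf₂ m
  have hc_centred (e : E) : ∫ q, inner ℝ e (f (coupledPast δ m q)) ∂(P.prod P) = 0 := by
    exact (integral_comp_eq_of_identDistrib (f := fun s => inner ℝ e (f s))
      (h.identDistrib_coupledPast m 0) (stronglyMeasurable_const.inner hf)).trans (hzero e)
  have hlag : StronglyMeasurable fun s : ℕ → S => inner ℝ (f fun i => s (i + m)) (f s) :=
    (hf.comp_measurable (by fun_prop)).inner hf
  have hshift (l : ℤ) : ∫ ω, inner ℝ (f (past δ l ω)) (f (past δ (l + m) ω)) ∂P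
      = ∫ q : Ω × Ω, inner ℝ (f (past δ 0 q.1)) (f (past δ m q.1)) ∂(P.prod P) := by
    have := integral_comp_eq_of_identDistrib ((h.identDistrib_past (l + m) m).trans
      (identDistrib_fst (h.measurable_past m)).symm) hlag
    simpa only [past_tail, ← past_tail δ 0 m, zero_add] using this
  have hsplit : ∫ ω, inner ℝ (f (past δ k ω)) (f (past δ (k + m) ω)) ∂P
      = ∫ q, inner ℝ (f (past δ 0 q.1)) (f (past δ m q.1) - f (coupledPast δ m q))
          ∂(P.prod P) := by
    simp only [inner_sub_right]
    rw [integral_sub (integrable_inner h₀ hm) (integrable_inner h₀ hc), hshift,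
      integral_inner_comp_eq_zero_of_indepFun (h.indepFun_past_coupledPast m)
        ((h.measurable_past 0).comp measurable_fst).aemeasurable
        (h.measurable_coupledPast m).aemeasurable hf hf h₀ hc hc_centred, sub_zero]
  rw [hsplit, ← eLpNorm_comp_eq_of_identDistrib (identDistrib_fst (h.measurable_past 0)) hf]
  exact abs_integral_inner_le h₀ (hm.sub hc)

theorem IsMApproximable.exists_integral_norm_sum_sq_le [IsProbabilityMeasure P]
    (hf : IsMApproximable P 2 δ f) (h : IsIID P δ)
    (hzero : ∀ e, ∫ ω, inner ℝ e (f (past δ 0 ω)) ∂P = 0) :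
    ∃ c : ℝ, ∀ (l : ℤ) (n : ℕ),
      ∫ ω, ‖∑ k ∈ Finset.Icc 1 n, f (past δ (k + l) ω)‖ ^ 2 ∂P ≤ c * n := by
  set L := (eLpNorm (fun ω => f (past δ 0 ω)) 2 P).toReal
  have hmem := hf.memLp_past h
  have hsq (k : ℤ) : ∫ ω, ‖f (past δ k ω)‖ ^ 2 ∂P ≤ L * L := by
    simpa only [real_inner_self_eq_norm_sq, eLpNorm_comp_eq_of_identDistrib
      (h.identDistrib_past k 0) hf.stronglyMeasurable] using
      (le_abs_self _).trans (abs_integral_inner_le (hmem k) (hmem k))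
  have hsummable : Summable fun m => L * (couplingError P 2 δ f (m + 1)).toReal :=
    (((summable_nat_add_iff 1).2 (ENNReal.summable_toReal hf.tsum_ne_top)).mul_left L)
  refine ⟨L * L + 2 * ∑' m, L * (couplingError P 2 δ f (m + 1)).toReal, fun l n => ?_⟩
  have hbound := integral_norm_sum_sq_le (Z := fun k ω => f (past δ ((k + 1 : ℕ) + l) ω))
    (fun k => hmem _) (fun k => hsq _) hsummable (fun k m => ?_) n
  · simpa only [← Finset.Ico_add_one_right_eq_Icc, Finset.sum_Ico_eq_sum_range,
      Nat.add_sub_cancel, add_comm 1] using hbound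
  · have hlag : ((k + m + 1 + 1 : ℕ) : ℤ) + l = (k + 1 : ℕ) + l + (m + 1 : ℕ) := by
      push_cast
      ring
    simpa only [hlag] using
      h.abs_covariance_le hf.stronglyMeasurable hf.memLp hzero ((k + 1 : ℕ) + l) (m + 1)

end SecondMoments

section OrthonormalSums

variable {H ι : Type*} [NormedAddCommGroup H] [InnerProductSpace ℝ H] {s : Finset ι} {v : ι → H}

theorem norm_sq_orthonormal_sum (hv : Orthonormal ℝ fun j : s => v j) (a : ι → ℝ) :
    ‖∑ j ∈ s, a j • v j‖ ^ 2 = ∑ j ∈ s, a j ^ 2 := by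
  rw [← real_inner_self_eq_norm_sq, ← Finset.sum_coe_sort s fun j => a j • v j,
    hv.inner_sum (fun j => a j) (fun j => a j), ← Finset.sum_coe_sort s fun j => a j ^ 2]
  exact Finset.sum_congr rfl fun j _ => (sq (a j)).symm

theorem norm_orthonormal_sum_le (hv : Orthonormal ℝ fun j : s => v j) {a : ι → ℝ} {x : H} {τ : ℝ}
    (hτ : 0 ≤ τ) (ha : ∀ j ∈ s, |a j| ≤ τ * |inner ℝ (v j) x|) :
    ‖∑ j ∈ s, a j • v j‖ ≤ τ * ‖x‖ := by
  have hbessel : ∑ j ∈ s, inner ℝ (v j) x ^ 2 ≤ ‖x‖ ^ 2 := by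
    rw [← Finset.sum_coe_sort s fun j => inner ℝ (v j) x ^ 2]
    simpa only [Real.norm_eq_abs, sq_abs] using hv.sum_inner_products_le x (s := Finset.univ)
  refine le_of_sq_le_sq ?_ (by positivity)
  calc ‖∑ j ∈ s, a j • v j‖ ^ 2 = ∑ j ∈ s, a j ^ 2 := norm_sq_orthonormal_sum hv a
    _ ≤ ∑ j ∈ s, τ ^ 2 * inner ℝ (v j) x ^ 2 := Finset.sum_le_sum fun j hj => by
        rw [← mul_pow]
        exact sq_le_sq.2 (by simpa only [abs_mul, abs_of_nonneg hτ] using ha j hj)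
    _ ≤ (τ * ‖x‖) ^ 2 := by
        rw [← Finset.mul_sum, mul_pow]
        gcongr

theorem norm_sub_sum_inner_smul_le (hv : Orthonormal ℝ fun j : s => v j) (x : H) (a : ι → ℝ) :
    ‖x - ∑ j ∈ s, inner ℝ (v j) x • v j‖ ≤ ‖x - ∑ j ∈ s, a j • v j‖ := by
  set p := ∑ j ∈ s, inner ℝ (v j) x • v j with hp
  set w := ∑ j ∈ s, (inner ℝ (v j) x - a j) • v j with hw
  have horth : inner ℝ (x - p) w = 0 := by
    rw [hw, inner_sum]
    refine Finset.sum_eq_zero fun j hj => ?_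
    have hpj : inner ℝ (v j) p = inner ℝ (v j) x := by
      rw [hp, ← Finset.sum_coe_sort s fun j => inner ℝ (v j) x • v j]
      exact hv.inner_right_fintype (fun j : s => inner ℝ (v j) x) ⟨j, hj⟩
    rw [inner_smul_right, real_inner_comm (v j) (x - p), inner_sub_right, hpj, sub_self, mul_zero]
  have hsum : x - ∑ j ∈ s, a j • v j = (x - p) + w := by
    simp only [hw, hp, sub_smul, Finset.sum_sub_distrib]
    abel
  rw [hsum, ← sq_le_sq₀ (norm_nonneg _) (norm_nonneg _), norm_add_sq_real, horth]
  linarith [sq_nonneg ‖w‖]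

end OrthonormalSums

section EmpiricalOperators

variable {H₁ H₂ : Type*} [NormedAddCommGroup H₁] [InnerProductSpace ℝ H₁]
  [NormedAddCommGroup H₂] [InnerProductSpace ℝ H₂] (n : ℕ) (x : ℕ → H₁) (y : ℕ → H₂)

theorem empiricalOperator_apply (z : H₁) :
    empiricalOperator n x y z = (n : ℝ)⁻¹ • ∑ k ∈ Finset.Icc 1 n, inner ℝ (x k) z • y k := by
  simp only [empiricalOperator, _root_.smul_apply, _root_.sum_apply,
    tensor_apply]

theorem empiricalOperator_apply_mem_span (z : H₁) :
    empiricalOperator n x y z ∈ Submodule.span ℝ (Set.range fun k : Finset.Icc 1 n => y k) := by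
  rw [empiricalOperator_apply]
  exact Submodule.smul_mem _ _ (Submodule.sum_mem _ fun k hk =>
    Submodule.smul_mem _ _ (Submodule.subset_span ⟨⟨k, hk⟩, rfl⟩))

theorem norm_empiricalOperator_self_le :
    ‖empiricalOperator n x x‖ ≤ (n : ℝ)⁻¹ * ∑ k ∈ Finset.Icc 1 n, ‖x k‖ ^ 2 := by
  rw [empiricalOperator, norm_smul, norm_inv, Real.norm_natCast]
  gcongr
  refine norm_sum_le_of_le _ fun k _ => ?_
  rw [tensor, InnerProductSpace.norm_rankOne, sq]

open scoped TensorProduct in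
/- The norm of the inner product space `H₁ ⊗ H₂` is the Hilbert–Schmidt norm, which, unlike the
operator norm, can be estimated in mean square. -/
theorem norm_empiricalOperator_le :
    ‖empiricalOperator n x y‖ ≤ (n : ℝ)⁻¹ * ‖∑ k ∈ Finset.Icc 1 n, x k ⊗ₜ[ℝ] y k‖ := by
  refine ContinuousLinearMap.opNorm_le_bound _ (by positivity) fun z => ?_
  rw [empiricalOperator_apply, norm_smul, norm_inv, Real.norm_natCast, mul_assoc]
  gcongr
  set t := ∑ k ∈ Finset.Icc 1 n, x k ⊗ₜ[ℝ] y k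
  set w := ∑ k ∈ Finset.Icc 1 n, inner ℝ (x k) z • y k with hw
  have hpairing : inner ℝ t (z ⊗ₜ[ℝ] w) = ‖w‖ * ‖w‖ := by
    rw [← real_inner_self_eq_norm_mul_norm]
    nth_rw 2 [hw]
    simp only [t, sum_inner, TensorProduct.inner_tmul, real_inner_smul_left]
  have hcauchy : ‖w‖ * ‖w‖ ≤ (‖t‖ * ‖z‖) * ‖w‖ := by
    rw [← hpairing, mul_assoc, ← TensorProduct.norm_tmul (𝕜 := ℝ)]
    exact real_inner_le_norm t (z ⊗ₜ[ℝ] w)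
  rcases (norm_nonneg w).eq_or_lt' with hzero | hpos
  · rw [hzero]
    positivity
  · exact le_of_mul_le_mul_right hcauchy hpos

variable {n x y}

theorem empiricalOperator_eq_comp_add {Ψ : H₁ →L[ℝ] H₂} {e : ℕ → H₂}
    (hy : ∀ k, 1 ≤ k → y k = Ψ (x k) + e k) :
    empiricalOperator n x y = Ψ ∘L empiricalOperator n x x + empiricalOperator n x e := by
  ext z
  simp only [_root_.add_apply, ContinuousLinearMap.comp_apply,
    empiricalOperator_apply, map_smul, map_sum, ← smul_add, ← Finset.sum_add_distrib]
  congr 1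
  exact Finset.sum_congr rfl fun k hk => by rw [hy k (Finset.mem_Icc.1 hk).1]

end EmpiricalOperators

section Truncation

variable {n : ℕ} {m : ℝ} {lam : ℕ → ℝ} {j : ℕ}

theorem div_le_of_le_truncationLevel (hanti : ∀ i j, 1 ≤ i → i ≤ j → lam j ≤ lam i)
    (hlam : 0 ≤ lam 1) (hj : 1 ≤ j) (hjK : j ≤ truncationLevel n m lam) :
    0 < lam j ∧ lam 1 / lam j ≤ m := by
  have hlevel : truncationLevel n m lam ∈
      {j : ℕ | 1 ≤ j ∧ j ≤ n ∧ 0 < lam j ∧ lam 1 / lam j ≤ m} :=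
    Nat.sSup_mem (Set.nonempty_iff_ne_empty.2 fun hempty => by
      rw [truncationLevel, hempty, csSup_empty] at hjK
      exact Nat.not_succ_le_zero _ (hj.trans hjK)) ⟨n, fun _ hi => hi.2.1⟩
  obtain ⟨-, -, hpos, hle⟩ := hlevel
  have hmono := hanti j _ hj hjK
  exact ⟨hpos.trans_le hmono, (div_le_div_of_nonneg_left hlam hpos hmono).trans hle⟩

theorem lt_div_of_truncationLevel_lt (hj : 1 ≤ j) (hjn : j ≤ n) (hpos : 0 < lam j)
    (hK : truncationLevel n m lam < j) : m < lam 1 / lam j := by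
  by_contra! hle
  exact hK.not_ge (le_csSup ⟨n, fun _ hi => hi.2.1⟩ ⟨hj, hjn, hpos, hle⟩)

end Truncation

section Eigensystem

variable {H H₂ : Type*} [NormedAddCommGroup H] [InnerProductSpace ℝ H]
  [NormedAddCommGroup H₂] [InnerProductSpace ℝ H₂]

/-- The projection `∑_{j ≤ K} v_j ⊗ v_j` on the first `K` principal components. -/
def principalProj (K : ℕ) (v : ℕ → H) (z : H) : H :=
  ∑ j ∈ Finset.Icc 1 K, inner ℝ (v j) z • v j

/-- The regularized inverse `∑_{j ≤ K} lam_j⁻¹ v_j ⊗ v_j` of `∑_j lam_j v_j ⊗ v_j`. -/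
def truncatedInverse (K : ℕ) (lam : ℕ → ℝ) (v : ℕ → H) (z : H) : H :=
  ∑ j ∈ Finset.Icc 1 K, (inner ℝ (v j) z / lam j) • v j

variable {T : H →L[ℝ] H} {lam : ℕ → ℝ} {v : ℕ → H} {K : ℕ}

theorem pcEstimator_eq (n K : ℕ) (x : ℕ → H) (y : ℕ → H₂) (lam : ℕ → ℝ) (v : ℕ → H) (z : H) :
    pcEstimator n K x y lam v z = empiricalOperator n x y (truncatedInverse K lam v z) := by
  simp only [pcEstimator, truncatedInverse, map_sum, map_smul]

namespace IsEigensystem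

theorem orthonormal_finset (h : IsEigensystem T lam v) {s : Finset ℕ}
    (hs : ∀ j ∈ s, 1 ≤ j ∧ lam j ≠ 0) : Orthonormal ℝ fun j : s => v j :=
  h.orthonormal.comp (fun j : s => ⟨j, hs j j.2⟩) fun _ _ hij => Subtype.ext (Subtype.mk.inj hij)

theorem apply_eigenvector (h : IsEigensystem T lam v) {j : ℕ} (hj : 1 ≤ j) (hlam : lam j ≠ 0) :
    T (v j) = lam j • v j := by
  have horth (i : ℕ) (hi : i ≠ j - 1) :
      lam (i + 1) • tensor (v (i + 1)) (v (i + 1)) (v j) = 0 := by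
    by_cases hzero : lam (i + 1) = 0
    · rw [hzero, zero_smul]
    · have hinner : inner ℝ (v (i + 1)) (v j) = 0 :=
        h.orthonormal.inner_eq_zero (i := ⟨i + 1, i.succ_pos, hzero⟩) (j := ⟨j, hj, hlam⟩)
          (by simp only [ne_eq, Subtype.mk.injEq]; omega)
      rw [tensor_apply, hinner, zero_smul, smul_zero]
  rw [(h.hasSum (v j)).unique (hasSum_single (j - 1) horth), Nat.sub_add_cancel hj, tensor_apply,
    real_inner_self_eq_norm_sq, h.orthonormal.norm_eq_one ⟨j, hj, hlam⟩, one_pow, one_smul]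

theorem norm_sum_le (h : IsEigensystem T lam v) {s : Finset ℕ} {τ : ℝ} (hτ : 0 ≤ τ)
    (hs : ∀ j ∈ s, 1 ≤ j ∧ lam j ≤ τ) (d : H) :
    ‖∑ j ∈ s, (lam j * inner ℝ (v j) d) • v j‖ ≤ τ * ‖d‖ := by
  rw [← Finset.sum_filter_of_ne (p := fun j => lam j ≠ 0) fun j _ hj hlam =>
    hj (by rw [hlam, zero_mul, zero_smul])]
  refine norm_orthonormal_sum_le (h.orthonormal_finset fun j hj => ?_) hτ fun j hj => ?_
  · exact ⟨(hs j (Finset.mem_filter.1 hj).1).1, (Finset.mem_filter.1 hj).2⟩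
  · obtain ⟨hj₁, hjτ⟩ := hs j (Finset.mem_filter.1 hj).1
    rw [abs_mul, abs_of_nonneg (h.nonneg j hj₁)]
    gcongr

theorem norm_apply_sub_sum_le (h : IsEigensystem T lam v) {τ : ℝ} (hτ : 0 ≤ τ)
    (hK : ∀ j, K < j → lam j ≤ τ) (d : H) :
    ‖T d - ∑ j ∈ Finset.Icc 1 K, (lam j * inner ℝ (v j) d) • v j‖ ≤ τ * ‖d‖ := by
  have hlim := ((h.hasSum d).tendsto_sum_nat.sub_const
    (∑ j ∈ Finset.Icc 1 K, (lam j * inner ℝ (v j) d) • v j)).norm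
  refine le_of_tendsto hlim ((eventually_ge_atTop K).mono fun N hN => ?_)
  have htail : ∑ j ∈ Finset.range N, lam (j + 1) • tensor (v (j + 1)) (v (j + 1)) d
      - ∑ j ∈ Finset.Icc 1 K, (lam j * inner ℝ (v j) d) • v j
      = ∑ j ∈ Finset.Ico (K + 1) (N + 1), (lam j * inner ℝ (v j) d) • v j := by
    simp only [tensor_apply, smul_smul]
    rw [Finset.range_eq_Ico, Finset.sum_Ico_add' fun j => (lam j * inner ℝ (v j) d) • v j,
      ← Finset.Ico_add_one_right_eq_Icc, zero_add, sub_eq_iff_eq_add',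
      Finset.sum_Ico_consecutive _ (by omega) (by omega)]
  rw [htail]
  refine h.norm_sum_le hτ (fun j hj => ?_) d
  have hKj := (Finset.mem_Ico.1 hj).1
  exact ⟨K.succ_pos.trans_le hKj, hK j hKj⟩

theorem norm_apply_le (h : IsEigensystem T lam v) (d : H) : ‖T d‖ ≤ lam 1 * ‖d‖ := by
  simpa only [Finset.Icc_eq_empty_of_lt one_pos, Finset.sum_empty, sub_zero] using
    h.norm_apply_sub_sum_le (K := 0) (h.nonneg 1 le_rfl) (fun j hj => h.antitone 1 j le_rfl hj) d

theorem le_opNorm (h : IsEigensystem T lam v) : lam 1 ≤ ‖T‖ := by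
  rcases eq_or_ne (lam 1) 0 with hzero | hne
  · rw [hzero]
    exact norm_nonneg T
  · have hv : ‖v 1‖ = 1 := h.orthonormal.norm_eq_one ⟨1, le_rfl, hne⟩
    have := T.le_opNorm (v 1)
    rwa [h.apply_eigenvector le_rfl hne, norm_smul, hv, mul_one, mul_one, Real.norm_eq_abs,
      abs_of_nonneg (h.nonneg 1 le_rfl)] at this

theorem apply_truncatedInverse (h : IsEigensystem T lam v) (hK : ∀ j, 1 ≤ j → j ≤ K → lam j ≠ 0)
    (z : H) : T (truncatedInverse K lam v z) = principalProj K v z := by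
  simp only [truncatedInverse, principalProj, map_sum, map_smul]
  refine Finset.sum_congr rfl fun j hj => ?_
  obtain ⟨hj₁, hjK⟩ := Finset.mem_Icc.1 hj
  rw [h.apply_eigenvector hj₁ (hK j hj₁ hjK), smul_smul, div_mul_cancel₀ _ (hK j hj₁ hjK)]

theorem norm_truncatedInverse_le (h : IsEigensystem T lam v) {c : ℝ} (hc : 0 ≤ c)
    (hK : ∀ j, 1 ≤ j → j ≤ K → 0 < lam j ∧ (lam j)⁻¹ ≤ c) (z : H) :
    ‖truncatedInverse K lam v z‖ ≤ c * ‖z‖ := by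
  have hpos (j : ℕ) (hj : j ∈ Finset.Icc 1 K) : 1 ≤ j ∧ 0 < lam j ∧ (lam j)⁻¹ ≤ c :=
    ⟨(Finset.mem_Icc.1 hj).1, hK j (Finset.mem_Icc.1 hj).1 (Finset.mem_Icc.1 hj).2⟩
  refine norm_orthonormal_sum_le
    (h.orthonormal_finset fun j hj => ⟨(hpos j hj).1, (hpos j hj).2.1.ne'⟩) hc fun j hj => ?_
  obtain ⟨-, hj, hle⟩ := hpos j hj
  rw [abs_div, abs_of_pos hj, div_eq_inv_mul]
  gcongr

theorem norm_sub_principalProj_le (h : IsEigensystem T lam v)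
    (hK : ∀ j, 1 ≤ j → j ≤ K → lam j ≠ 0) {τ : ℝ} (hτ : 0 ≤ τ) (hKτ : ∀ j, K < j → lam j ≤ τ)
    (z c d : H) : ‖z - principalProj K v z‖ ≤ ‖z - c‖ + ‖T d - c‖ + τ * ‖d‖ := by
  have hon : Orthonormal ℝ fun j : Finset.Icc 1 K => v j := h.orthonormal_finset fun j hj =>
    ⟨(Finset.mem_Icc.1 hj).1, hK j (Finset.mem_Icc.1 hj).1 (Finset.mem_Icc.1 hj).2⟩
  calc ‖z - principalProj K v z‖
      ≤ ‖z - ∑ j ∈ Finset.Icc 1 K, (lam j * inner ℝ (v j) d) • v j‖ :=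
        norm_sub_sum_inner_smul_le hon z _
    _ = ‖(z - c) - (T d - c)
          + (T d - ∑ j ∈ Finset.Icc 1 K, (lam j * inner ℝ (v j) d) • v j)‖ := by
        congr 1
        abel
    _ ≤ ‖z - c‖ + ‖T d - c‖ + τ * ‖d‖ :=
        (norm_add_le _ _).trans (add_le_add (norm_sub_le _ _) (h.norm_apply_sub_sum_le hτ hKτ d))

end IsEigensystem

end Eigensystem

section TruncatedEstimator

variable {H H₂ : Type*} [NormedAddCommGroup H] [InnerProductSpace ℝ H]
  [NormedAddCommGroup H₂] [InnerProductSpace ℝ H₂] {n : ℕ} {x : ℕ → H} {lam : ℕ → ℝ} {v : ℕ → H}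

theorem IsEigensystem.eq_zero_of_lt (h : IsEigensystem (empiricalOperator n x x) lam v) {j : ℕ}
    (hj : n < j) : lam j = 0 := by
  by_contra hne
  have hs (i : ℕ) (hi : i ∈ Finset.Icc 1 j) : 1 ≤ i ∧ lam i ≠ 0 := by
    obtain ⟨hi₁, hij⟩ := Finset.mem_Icc.1 hi
    have hpos := (h.nonneg j (hi₁.trans hij)).lt_of_ne' hne
    exact ⟨hi₁, (hpos.trans_le (h.antitone i j hi₁ hij)).ne'⟩
  have hli : LinearIndependent ℝ fun i : Finset.Icc 1 j => v i :=
    (h.orthonormal_finset hs).linearIndependent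
  set W := Submodule.span ℝ (Set.range fun k : Finset.Icc 1 n => x k)
  have hmem (i : Finset.Icc 1 j) : v i ∈ W := by
    obtain ⟨hi₁, hi⟩ := hs i i.2
    have hTv : empiricalOperator n x x ((lam i)⁻¹ • v i) = v i := by
      rw [map_smul, h.apply_eigenvector hi₁ hi, inv_smul_smul₀ hi]
    exact hTv ▸ empiricalOperator_apply_mem_span n x x _
  have : FiniteDimensional ℝ W := FiniteDimensional.span_of_finite ℝ (Set.finite_range _)
  have hliW : LinearIndependent ℝ fun i : Finset.Icc 1 j => (⟨v i, hmem i⟩ : W) :=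
    LinearIndependent.of_comp W.subtype hli
  have hcard := hliW.fintype_card_le_finrank.trans
    (finrank_range_le_card (R := ℝ) fun k : Finset.Icc 1 n => x k)
  simp only [Fintype.card_coe, Nat.card_Icc, Nat.add_sub_cancel] at hcard
  omega

theorem IsEigensystem.le_div_of_truncationLevel_lt
    (h : IsEigensystem (empiricalOperator n x x) lam v) {m : ℝ} (hm : 0 < m) {j : ℕ}
    (hj : truncationLevel n m lam < j) : lam j ≤ lam 1 / m := by
  have hj₁ : 1 ≤ j := Nat.one_le_of_lt hj
  rcases (h.nonneg j hj₁).eq_or_lt with hzero | hpos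
  · rw [← hzero]
    exact div_nonneg (h.nonneg 1 le_rfl) hm.le
  · have hjn : j ≤ n := not_lt.1 fun hnj => hpos.ne' (h.eq_zero_of_lt hnj)
    have := lt_div_of_truncationLevel_lt hj₁ hjn hpos hj
    exact (le_div_comm₀ hm hpos).1 this.le

theorem IsEigensystem.norm_sub_principalProj_truncationLevel_le
    (h : IsEigensystem (empiricalOperator n x x) lam v) {m : ℝ} (hm : 0 < m) (z c d : H) :
    ‖z - principalProj (truncationLevel n m lam) v z‖
      ≤ ‖z - c‖ + ‖empiricalOperator n x x d - c‖ + lam 1 / m * ‖d‖ :=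
  h.norm_sub_principalProj_le
    (fun _ hj hjK => (div_le_of_le_truncationLevel h.antitone (h.nonneg 1 le_rfl) hj hjK).1.ne')
    (div_nonneg (h.nonneg 1 le_rfl) hm.le) (fun _ => h.le_div_of_truncationLevel_lt hm) z c d

theorem IsEigensystem.norm_truncatedInverse_truncationLevel_le {T : H →L[ℝ] H}
    (h : IsEigensystem T lam v) {m : ℝ} (hm : 0 ≤ m) (z : H) :
    ‖truncatedInverse (truncationLevel n m lam) lam v z‖ ≤ m / lam 1 * ‖z‖ := by
  have hlam := h.nonneg 1 le_rfl
  refine h.norm_truncatedInverse_le (div_nonneg hm hlam) (fun j hj hjK => ?_) z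
  obtain ⟨hpos, hle⟩ := div_le_of_le_truncationLevel h.antitone hlam hj hjK
  refine ⟨hpos, ?_⟩
  rwa [le_div_iff₀ (hpos.trans_le (h.antitone 1 j le_rfl hj)), inv_mul_eq_div]

theorem IsEigensystem.norm_sub_pcEstimator_le
    (h : IsEigensystem (empiricalOperator n x x) lam v) {Ψ : H →L[ℝ] H₂} {y e : ℕ → H₂}
    (hy : ∀ k, 1 ≤ k → y k = Ψ (x k) + e k) (m : ℝ) (z : H) :
    ‖Ψ z - pcEstimator n (truncationLevel n m lam) x y lam v z‖
      ≤ ‖Ψ‖ * ‖z - principalProj (truncationLevel n m lam) v z‖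
        + ‖empiricalOperator n x e (truncatedInverse (truncationLevel n m lam) lam v z)‖ := by
  have hK (j : ℕ) (hj : 1 ≤ j) (hjK : j ≤ truncationLevel n m lam) : lam j ≠ 0 :=
    (div_le_of_le_truncationLevel h.antitone (h.nonneg 1 le_rfl) hj hjK).1.ne'
  rw [pcEstimator_eq, empiricalOperator_eq_comp_add hy, _root_.add_apply,
    ContinuousLinearMap.comp_apply, h.apply_truncatedInverse hK, ← sub_sub, ← map_sub]
  exact (norm_sub_le _ _).trans (add_le_add_left (Ψ.le_opNorm _) _)

end TruncatedEstimator

section ConvergenceInMeasure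

variable {Ω ι : Type*} [MeasurableSpace Ω] {P : Measure Ω} {l : Filter ι}
  {E F G : Type*} [NormedAddCommGroup E] [NormedAddCommGroup F] [NormedAddCommGroup G]

theorem tendstoInMeasure_zero_of_norm_lt {f : ι → Ω → E} {g : ι → Ω → F} {k : ι → Ω → G}
    (hg : TendstoInMeasure P g l 0) (hk : TendstoInMeasure P k l 0)
    (hf : ∀ ε > 0, ∃ ρ > 0, ∀ᶠ i in l, ∀ᵐ ω ∂P, ‖g i ω‖ < ρ → ‖k i ω‖ < ρ → ‖f i ω‖ < ε) :
    TendstoInMeasure P f l 0 := by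
  simp only [tendstoInMeasure_iff_norm, Pi.zero_apply, sub_zero] at hg hk ⊢
  intro ε hε
  obtain ⟨ρ, hρ, hlt⟩ := hf ε hε
  have hlim : Tendsto (fun i => P {ω | ρ ≤ ‖g i ω‖} + P {ω | ρ ≤ ‖k i ω‖}) l (𝓝 0) := by
    simpa only [add_zero] using (hg ρ hρ).add (hk ρ hρ)
  refine tendsto_of_tendsto_of_tendsto_of_le_of_le' tendsto_const_nhds hlim
    (Eventually.of_forall fun _ => zero_le) ?_
  filter_upwards [hlt] with i hi
  refine (measure_mono_ae ?_).trans (measure_union_le _ _)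
  filter_upwards [hi] with ω hω hbad
  change ρ ≤ ‖g i ω‖ ∨ ρ ≤ ‖k i ω‖
  by_contra! hsmall
  exact (hω hsmall.1 hsmall.2).not_ge hbad

theorem tendstoInMeasure_zero_of_norm_le_add {f : ι → Ω → E} {g : ι → Ω → F} {k : ι → Ω → G}
    {a b : ℝ} (hg : TendstoInMeasure P g l 0) (hk : TendstoInMeasure P k l 0)
    (ha : 0 ≤ a) (hb : 0 ≤ b)
    (hf : ∀ᶠ i in l, ∀ᵐ ω ∂P, ‖f i ω‖ ≤ a * ‖g i ω‖ + b * ‖k i ω‖) :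
    TendstoInMeasure P f l 0 := by
  refine tendstoInMeasure_zero_of_norm_lt hg hk fun ε hε =>
    ⟨ε / (a + b + 1), by positivity, ?_⟩
  filter_upwards [hf] with i hi
  filter_upwards [hi] with ω hω hgω hkω
  calc ‖f i ω‖ ≤ a * ‖g i ω‖ + b * ‖k i ω‖ := hω
    _ ≤ a * (ε / (a + b + 1)) + b * (ε / (a + b + 1)) := by gcongr
    _ < (a + b + 1) * (ε / (a + b + 1)) := by linarith [show 0 < ε / (a + b + 1) by positivity]
    _ = ε := mul_div_cancel₀ ε (by positivity)

theorem tendstoInMeasure_zero_of_finset {κ : Type*} {f : ι → Ω → E} {g : κ → ι → Ω → F}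
    (hg : ∀ d, TendstoInMeasure P (g d) l 0)
    (hf : ∀ ε > 0, ∀ η > 0, ∃ (D : Finset κ) (A : ι → Set Ω), (∀ i, P (A i) ≤ η) ∧
      ∃ ρ > 0, ∀ᶠ i in l, ∀ᵐ ω ∂P, ω ∉ A i → (∀ d ∈ D, ‖g d i ω‖ < ρ) → ‖f i ω‖ < ε) :
    TendstoInMeasure P f l 0 := by
  simp only [tendstoInMeasure_iff_norm, Pi.zero_apply, sub_zero] at hg ⊢
  refine fun ε hε => ENNReal.tendsto_nhds_zero.2 fun η hη => ?_
  obtain ⟨D, A, hA, ρ, hρ, hlt⟩ := hf ε hε (η / 2) (ENNReal.half_pos hη.ne')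
  have hsum : Tendsto (fun i => ∑ d ∈ D, P {ω | ρ ≤ ‖g d i ω‖}) l (𝓝 0) := by
    simpa only [Finset.sum_const_zero] using tendsto_finsetSum D fun d _ => hg d ρ hρ
  filter_upwards [hlt, ENNReal.tendsto_nhds_zero.1 hsum _ (ENNReal.half_pos hη.ne')] with i hi hsum
  refine (measure_mono_ae (t := A i ∪ ⋃ d ∈ D, {ω | ρ ≤ ‖g d i ω‖}) ?_).trans
    ((measure_union_le _ _).trans ((add_le_add (hA i)
      ((measure_biUnion_finset_le D _).trans hsum)).trans_eq (ENNReal.add_halves η)))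
  filter_upwards [hi] with ω hω hbad
  by_contra hgood
  obtain ⟨hωA, hωD⟩ := not_or.1 hgood
  refine (hω hωA fun d hd => not_le.1 fun hle => hωD ?_).not_ge hbad
  exact Set.mem_iUnion₂.2 ⟨d, hd, hle⟩

theorem tendstoInMeasure_zero_of_integral_norm_le {f : ι → Ω → E} {b : ι → ℝ}
    (hf : ∀ i, Integrable (f i) P) (hb : ∀ᶠ i in l, ∫ ω, ‖f i ω‖ ∂P ≤ b i)
    (hlim : Tendsto b l (𝓝 0)) : TendstoInMeasure P f l 0 := by
  refine tendstoInMeasure_of_tendsto_eLpNorm one_ne_zero (fun i => (hf i).1)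
    aestronglyMeasurable_zero ?_
  refine tendsto_of_tendsto_of_tendsto_of_le_of_le' tendsto_const_nhds
    (by simpa only [ENNReal.ofReal_zero] using ENNReal.tendsto_ofReal hlim)
    (Eventually.of_forall fun _ => zero_le) ?_
  filter_upwards [hb] with i hi
  rw [sub_zero, eLpNorm_one_eq_lintegral_enorm, ← ofReal_integral_norm_eq_lintegral_enorm (hf i)]
  exact ENNReal.ofReal_le_ofReal hi

theorem tendstoInMeasure_zero_of_integral_norm_sq_le {f : ι → Ω → E} {b : ι → ℝ}
    (hf : ∀ i, MemLp (f i) 2 P) (hb : ∀ᶠ i in l, ∫ ω, ‖f i ω‖ ^ 2 ∂P ≤ b i)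
    (hlim : Tendsto b l (𝓝 0)) : TendstoInMeasure P f l 0 := by
  have hsq : TendstoInMeasure P (fun i ω => ‖f i ω‖ ^ 2) l 0 :=
    tendstoInMeasure_zero_of_integral_norm_le
      (fun i => (hf i).integrable_norm_pow two_ne_zero)
      (by simpa only [norm_pow, norm_norm] using hb) hlim
  refine tendstoInMeasure_zero_of_norm_lt hsq hsq fun ε hε => ⟨ε ^ 2, by positivity,
    Eventually.of_forall fun i => ae_of_all _ fun ω hω _ => ?_⟩
  rw [norm_pow, norm_norm] at hω
  exact lt_of_pow_lt_pow_left₀ 2 hε.le hω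

end ConvergenceInMeasure

section SecondMomentOperator

variable {Ω : Type*} [MeasurableSpace Ω] {P : Measure Ω}
  {H₁ H₂ : Type*} [NormedAddCommGroup H₁] [InnerProductSpace ℝ H₁]
  [NormedAddCommGroup H₂] [InnerProductSpace ℝ H₂]

theorem integrable_tensor {X : Ω → H₁} {Y : Ω → H₂} (hX : MemLp X 2 P) (hY : MemLp Y 2 P) :
    Integrable (fun ω => tensor (X ω) (Y ω)) P :=
  memLp_one_iff_integrable.1 ((InnerProductSpace.rankOne ℝ :
    H₂ →L[ℝ] H₁ →L[ℝ] H₁ →L[ℝ] H₂).memLp_of_bilin (p := 2) (q := 2) 1 hY hX)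

theorem inner_integral_tensor [CompleteSpace H₂] {X : Ω → H₁} {Y : Ω → H₂} (hX : MemLp X 2 P)
    (hY : MemLp Y 2 P) (x : H₁) (y : H₂) :
    inner ℝ y ((∫ ω, tensor (X ω) (Y ω) ∂P) x) = ∫ ω, inner ℝ x (X ω) * inner ℝ y (Y ω) ∂P := by
  have hint := integrable_tensor hX hY
  rw [ContinuousLinearMap.integral_apply hint,
    ← integral_inner (hint.apply_continuousLinearMap x)]
  simp only [tensor_apply, inner_smul_right, real_inner_comm]

variable {H : Type*} [NormedAddCommGroup H] [InnerProductSpace ℝ H]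

/-- The uncentred covariance operator `E[X ⊗ X]`, the limit of the operators `Ĉ_n`. -/
def secondMoment (P : Measure Ω) (X : Ω → H) : H →L[ℝ] H := ∫ ω, tensor (X ω) (X ω) ∂P

variable [CompleteSpace H] {X : Ω → H}

theorem ae_inner_eq_zero_of_inner_secondMoment_eq_zero (hX : MemLp X 2 P) {d : H}
    (hd : inner ℝ d (secondMoment P X d) = 0) : ∀ᵐ ω ∂P, inner ℝ d (X ω) = 0 := by
  have hint : Integrable (fun ω => inner ℝ d (X ω) * inner ℝ d (X ω)) P :=
    (hX.const_inner d).integrable_mul (hX.const_inner d)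
  rw [secondMoment, inner_integral_tensor hX hX,
    integral_eq_zero_iff_of_nonneg (fun ω => mul_self_nonneg _) hint] at hd
  filter_upwards [hd] with ω hω
  exact mul_self_eq_zero.1 hω

variable [SecondCountableTopology H]

theorem ae_mem_closure_range_secondMoment (hX : MemLp X 2 P) :
    ∀ᵐ ω ∂P, X ω ∈ closure (Set.range (secondMoment P X)) := by
  set K := (LinearMap.range (secondMoment P X : H →ₗ[ℝ] H))ᗮ with hK
  have hdense (i : ℕ) :
      ∀ᵐ ω ∂P, inner ℝ ((TopologicalSpace.denseSeq K i : K) : H) (X ω) = 0 :=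
    ae_inner_eq_zero_of_inner_secondMoment_eq_zero hX <|
      Submodule.inner_left_of_mem_orthogonal (LinearMap.mem_range_self _ _)
        (TopologicalSpace.denseSeq K i).2
  filter_upwards [ae_all_iff.2 hdense] with ω hω
  have horth (d : K) : inner ℝ (d : H) (X ω) = 0 :=
    congrFun ((TopologicalSpace.denseRange_denseSeq K).equalizer
      (g := fun d : K => inner ℝ (d : H) (X ω)) (h := fun _ => 0) (by fun_prop) (by fun_prop)
      (funext hω)) d
  have hmem : X ω ∈ Kᗮ := (Submodule.mem_orthogonal _ _).2 fun d hd => horth ⟨d, hd⟩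
  rwa [hK, Submodule.orthogonal_orthogonal_eq_closure] at hmem

theorem exists_finset_measure_le_norm_sub_secondMoment [IsFiniteMeasure P] (hX : MemLp X 2 P)
    {ρ : ℝ} (hρ : 0 < ρ) {η : ENNReal} (hη : 0 < η) :
    ∃ D : Finset H, P {ω | ∀ d ∈ D, ρ ≤ ‖X ω - secondMoment P X d‖} ≤ η := by
  classical
  set C := secondMoment P X
  set u := TopologicalSpace.denseSeq H
  set A : ℕ → Set Ω := fun N => ⋂ i ∈ Finset.range N, {ω | ρ ≤ ‖X ω - C (u i)‖}
  have hmeas (N : ℕ) : NullMeasurableSet (A N) P :=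
    Finset.nullMeasurableSet_biInter _ fun i _ => nullMeasurableSet_le aemeasurable_const
      (hX.1.sub aestronglyMeasurable_const).norm.aemeasurable
  have hanti : Antitone A := fun M N hMN =>
    Set.biInter_subset_biInter_left (Finset.range_subset_range.2 hMN)
  have hnull : P (⋂ N, A N) = 0 := by
    refine measure_mono_null ?_ (ae_iff.1 (ae_mem_closure_range_secondMoment hX))
    rintro ω hω hclosure
    obtain ⟨_, ⟨_, ⟨i, rfl⟩, rfl⟩, hi⟩ := Metric.mem_closure_iff.1 (closure_minimal
      (C.continuous.range_subset_closure_image_dense (TopologicalSpace.denseRange_denseSeq H))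
      isClosed_closure hclosure) ρ hρ
    have hfar : ρ ≤ ‖X ω - C (u i)‖ :=
      Set.mem_iInter₂.1 (Set.mem_iInter.1 hω (i + 1)) i (Finset.self_mem_range_succ i)
    exact hfar.not_gt (by rwa [← dist_eq_norm])
  have hlim := tendsto_measure_iInter_atTop hmeas hanti ⟨0, measure_ne_top P _⟩
  rw [hnull] at hlim
  obtain ⟨N, hN⟩ := (hlim.eventually (ge_mem_nhds hη)).exists
  refine ⟨(Finset.range N).image u, le_trans (measure_mono fun ω hω => ?_) hN⟩
  exact Set.mem_iInter₂.2 fun i hi => hω _ (Finset.mem_image_of_mem _ hi)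

end SecondMomentOperator

open scoped TensorProduct in
theorem integral_inner_tmul_eq_zero {Ω : Type*} [MeasurableSpace Ω] {P : Measure Ω}
    {H₁ H₂ : Type*} [NormedAddCommGroup H₁] [InnerProductSpace ℝ H₁] [NormedAddCommGroup H₂]
    [InnerProductSpace ℝ H₂] [CompleteSpace H₂] {X : Ω → H₁} {Y : Ω → H₂} (hX : MemLp X 2 P)
    (hY : MemLp Y 2 P) (horth : ∫ ω, tensor (X ω) (Y ω) ∂P = 0) (b : H₁ ⊗[ℝ] H₂) :
    ∫ ω, inner ℝ b (X ω ⊗ₜ[ℝ] Y ω) ∂P = 0 := by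
  have hint (b : H₁ ⊗[ℝ] H₂) : Integrable (fun ω => inner ℝ b (X ω ⊗ₜ[ℝ] Y ω)) P :=
    (memLp_one_iff_integrable.1 ((TensorProduct.mkL ℝ H₁ H₂).memLp_of_bilin (p := 2) (q := 2)
      1 hX hY)).const_inner b
  induction b with
  | zero => simp only [inner_zero_left, integral_zero]
  | add b₁ b₂ hb₁ hb₂ =>
    simp only [inner_add_left]
    rw [integral_add (hint b₁) (hint b₂), hb₁, hb₂, add_zero]
  | tmul x y =>
    simp only [TensorProduct.inner_tmul]
    rw [← inner_integral_tensor hX hY, horth, _root_.zero_apply, inner_zero_right]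

section MeanSquareRates

variable {Ω S : Type*} [MeasurableSpace Ω] {P : Measure Ω} [MeasurableSpace S] {δ : ℤ → Ω → S}

/-- The causal process `X_k = f(δ_{k+l}, δ_{k+l-1}, …)`. The lag `l` allows the regressors to lag
behind the errors of a linear model. -/
def causal {H : Type*} (δ : ℤ → Ω → S) (f : (ℕ → S) → H) (l : ℤ) (k : ℕ) (ω : Ω) : H :=
  f (past δ (k + l) ω)

instance : ENNReal.HolderTriple 4 4 2 :=
  ⟨by rw [← two_mul, show (4 : ENNReal) = 2 * 2 by norm_num, ENNReal.mul_inv (by simp) (by simp),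
    ← mul_assoc, ENNReal.mul_inv_cancel (by simp) (by simp), one_mul]⟩

theorem IsMApproximable.integral_norm_causal_sq {H : Type*} [NormedAddCommGroup H]
    {p : ENNReal} {f : (ℕ → S) → H} (hf : IsMApproximable P p δ f) (h : IsIID P δ) (l : ℤ) (k : ℕ) :
    ∫ ω, ‖causal δ f l k ω‖ ^ 2 ∂P = ∫ ω, ‖f (past δ 0 ω)‖ ^ 2 ∂P :=
  integral_comp_eq_of_identDistrib (f := fun s => ‖f s‖ ^ 2) (h.identDistrib_past _ 0)
    (hf.stronglyMeasurable.norm.pow 2)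

theorem IsMApproximable.memLp_empiricalOperator {H₁ H₂ : Type*} [NormedAddCommGroup H₁]
    [InnerProductSpace ℝ H₁] [NormedAddCommGroup H₂] [InnerProductSpace ℝ H₂]
    {f : (ℕ → S) → H₁} {g : (ℕ → S) → H₂} (hf : IsMApproximable P 4 δ f)
    (hg : IsMApproximable P 4 δ g) (h : IsIID P δ) (l : ℤ) (n : ℕ) :
    MemLp (fun ω => empiricalOperator n (causal δ f l · ω) (causal δ g l · ω)) 2 P := by
  have hsum := memLp_finsetSum (Finset.Icc 1 n) fun k _ =>
    (InnerProductSpace.rankOne ℝ : H₂ →L[ℝ] H₁ →L[ℝ] H₁ →L[ℝ] H₂).memLp_of_bilin (p := 4) (q := 4)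
      2 (hg.memLp_past h (k + l)) (hf.memLp_past h (k + l))
  exact hsum.const_smul (n : ℝ)⁻¹

variable [IsProbabilityMeasure P]

theorem IsMApproximable.memLp_two {H : Type*} [NormedAddCommGroup H] {f : (ℕ → S) → H}
    (hf : IsMApproximable P 4 δ f) (h : IsIID P δ) (l : ℤ) (k : ℕ) :
    MemLp (causal δ f l k) 2 P :=
  (hf.memLp_past h _).mono_exponent (by norm_num)

theorem IsMApproximable.tendstoInMeasure_div_average_norm_sq {H : Type*} [NormedAddCommGroup H]
    {f : (ℕ → S) → H} (hf : IsMApproximable P 4 δ f) (h : IsIID P δ) (l : ℤ) {m : ℕ → ℝ}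
    (hm : Tendsto m atTop atTop) :
    TendstoInMeasure P
      (fun (n : ℕ) ω => ((n : ℝ)⁻¹ * ∑ k ∈ Finset.Icc 1 n, ‖causal δ f l k ω‖ ^ 2) / m n)
      atTop 0 := by
  set σ := ∫ ω, ‖f (past δ 0 ω)‖ ^ 2 ∂P
  have hint (k : ℕ) : Integrable (fun ω => ‖causal δ f l k ω‖ ^ 2) P :=
    (hf.memLp_two h l k).integrable_norm_pow two_ne_zero
  refine tendstoInMeasure_zero_of_integral_norm_le (b := fun n => σ / m n)
    (fun n => ((integrable_finsetSum _ fun k _ => hint k).const_mul _).div_const _) ?_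
    (hm.const_div_atTop σ)
  filter_upwards [hm.eventually_gt_atTop 0, eventually_ge_atTop 1] with n hmn hn
  have hnonneg (ω : Ω) :
      0 ≤ ((n : ℝ)⁻¹ * ∑ k ∈ Finset.Icc 1 n, ‖causal δ f l k ω‖ ^ 2) / m n := by positivity
  have hn₀ : (n : ℝ) ≠ 0 := by positivity
  simp only [Real.norm_of_nonneg (hnonneg _)]
  rw [integral_div, integral_const_mul, integral_finsetSum _ fun k _ => hint k]
  simp only [hf.integral_norm_causal_sq h, Finset.sum_const, Nat.card_Icc, Nat.add_sub_cancel,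
    nsmul_eq_mul, inv_mul_cancel_left₀ hn₀]
  exact le_rfl

variable {H₁ H₂ : Type*} [NormedAddCommGroup H₁] [InnerProductSpace ℝ H₁]
  [NormedAddCommGroup H₂] [InnerProductSpace ℝ H₂] {f : (ℕ → S) → H₁} {g : (ℕ → S) → H₂}

theorem IsMApproximable.tendstoInMeasure_average (hf : IsMApproximable P 2 δ f) (h : IsIID P δ)
    (hzero : ∀ e, ∫ ω, inner ℝ e (f (past δ 0 ω)) ∂P = 0) (l : ℤ) :
    TendstoInMeasure P
      (fun (n : ℕ) ω => (n : ℝ)⁻¹ • ∑ k ∈ Finset.Icc 1 n, causal δ f l k ω) atTop 0 := by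
  obtain ⟨c, hc⟩ := hf.exists_integral_norm_sum_sq_le h hzero
  refine tendstoInMeasure_zero_of_integral_norm_sq_le (b := fun n : ℕ => c * (n : ℝ)⁻¹)
    (fun n => (memLp_finsetSum _ fun k _ => hf.memLp_past h _).const_smul _) ?_
    (by simpa only [mul_zero] using tendsto_inv_atTop_nhds_zero_nat.const_mul c)
  filter_upwards [eventually_ge_atTop 1] with n hn
  simp only [norm_smul, mul_pow, integral_const_mul, norm_inv, Real.norm_natCast]
  calc (n : ℝ)⁻¹ ^ 2 * ∫ ω, ‖∑ k ∈ Finset.Icc 1 n, causal δ f l k ω‖ ^ 2 ∂P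
      ≤ (n : ℝ)⁻¹ ^ 2 * (c * n) := by gcongr; exact hc l n
    _ = c * (n : ℝ)⁻¹ := by field_simp

theorem IsMApproximable.tendstoInMeasure_empiricalOperator_apply [CompleteSpace H₁]
    (hf : IsMApproximable P 4 δ f) (h : IsIID P δ) (l : ℤ) (d : H₁) :
    TendstoInMeasure P
      (fun n ω => empiricalOperator n (causal δ f l · ω) (causal δ f l · ω) d -
        secondMoment P (fun ω => f (past δ 0 ω)) d) atTop 0 := by
  set e := secondMoment P (fun ω => f (past δ 0 ω)) d
  set B : H₁ →L[ℝ] H₁ →L[ℝ] H₁ := (innerSL ℝ d).smulRight (ContinuousLinearMap.id ℝ H₁)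
  have hBf (s : ℕ → S) : B (f s) (f s) = inner ℝ d (f s) • f s := rfl
  have hF : IsMApproximable P 2 δ fun s => B (f s) (f s) - e :=
    (hf.bilin hf h one_le_two B).sub (.const e) h one_le_two
  have hf₂ : MemLp (fun ω => f (past δ 0 ω)) 2 P := hf.memLp.mono_exponent (by norm_num)
  have hcentred (b : H₁) : ∫ ω, inner ℝ b (B (f (past δ 0 ω)) (f (past δ 0 ω)) - e) ∂P = 0 := by
    have hint : Integrable
        (fun ω => inner ℝ d (f (past δ 0 ω)) * inner ℝ b (f (past δ 0 ω))) P :=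
      (hf₂.const_inner d).integrable_mul (hf₂.const_inner b)
    simp only [hBf, inner_sub_right, inner_smul_right]
    rw [integral_sub hint (integrable_const _), ← inner_integral_tensor hf₂ hf₂]
    simp [e, secondMoment]
  refine (hF.tendstoInMeasure_average h hcentred l).congr' ?_ .rfl
  filter_upwards [eventually_ge_atTop 1] with n hn
  refine ae_of_all _ fun ω => ?_
  have hn₀ : (n : ℝ) ≠ 0 := by positivity
  simp only [causal, hBf, empiricalOperator_apply, real_inner_comm d, Finset.sum_sub_distrib,
    smul_sub, Finset.sum_const, Nat.card_Icc, Nat.add_sub_cancel, ← Nat.cast_smul_eq_nsmul ℝ,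
    smul_smul, inv_mul_cancel₀ hn₀, one_smul]

open scoped TensorProduct in
theorem IsMApproximable.exists_integral_norm_empiricalOperator_sq_le [CompleteSpace H₂]
    (hf : IsMApproximable P 4 δ f) (hg : IsMApproximable P 4 δ g) (h : IsIID P δ)
    (horth : ∫ ω, tensor (f (past δ 0 ω)) (g (past δ 0 ω)) ∂P = 0) :
    ∃ c : ℝ, ∀ (l : ℤ) (n : ℕ),
      ∫ ω, ‖empiricalOperator n (causal δ f l · ω) (causal δ g l · ω)‖ ^ 2 ∂P ≤ c * (n : ℝ)⁻¹ := by
  have hF : IsMApproximable P 2 δ fun s => TensorProduct.mkL ℝ H₁ H₂ (f s) (g s) :=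
    hf.bilin hg h one_le_two _
  have hcentred (b : H₁ ⊗[ℝ] H₂) :
      ∫ ω, inner ℝ b (TensorProduct.mkL ℝ H₁ H₂ (f (past δ 0 ω)) (g (past δ 0 ω))) ∂P = 0 :=
    integral_inner_tmul_eq_zero (hf.memLp.mono_exponent (by norm_num))
      (hg.memLp.mono_exponent (by norm_num)) horth b
  obtain ⟨c, hc⟩ := hF.exists_integral_norm_sum_sq_le h hcentred
  refine ⟨c, fun l n => ?_⟩
  have hU : MemLp (fun ω => ∑ k ∈ Finset.Icc 1 n, causal δ f l k ω ⊗ₜ[ℝ] causal δ g l k ω) 2 P :=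
    memLp_finsetSum _ fun k _ => hF.memLp_past h (k + l)
  calc ∫ ω, ‖empiricalOperator n (causal δ f l · ω) (causal δ g l · ω)‖ ^ 2 ∂P
      ≤ ∫ ω, (n : ℝ)⁻¹ ^ 2 *
          ‖∑ k ∈ Finset.Icc 1 n, causal δ f l k ω ⊗ₜ[ℝ] causal δ g l k ω‖ ^ 2 ∂P := by
        refine integral_mono
          ((hf.memLp_empiricalOperator hg h l n).integrable_norm_pow two_ne_zero)
          ((hU.integrable_norm_pow two_ne_zero).const_mul _) fun ω => ?_
        simp only [← mul_pow]
        gcongr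
        exact norm_empiricalOperator_le ..
    _ ≤ (n : ℝ)⁻¹ ^ 2 * (c * n) := by
        rw [integral_const_mul]
        gcongr
        exact hc l n
    _ = c * (n : ℝ)⁻¹ := by
        rcases eq_or_ne (n : ℝ) 0 with hn | hn
        · simp [hn]
        · field_simp

theorem IsMApproximable.tendstoInMeasure_mul_norm_empiricalOperator [CompleteSpace H₂]
    (hf : IsMApproximable P 4 δ f) (hg : IsMApproximable P 4 δ g) (h : IsIID P δ)
    (horth : ∫ ω, tensor (f (past δ 0 ω)) (g (past δ 0 ω)) ∂P = 0) (l : ℤ)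
    {m : ℕ → ℝ} (hm : m =o[atTop] fun n : ℕ => √n) :
    TendstoInMeasure P
      (fun (n : ℕ) ω => m n * (‖empiricalOperator n (causal δ f l · ω) (causal δ g l · ω)‖ *
        ‖causal δ f l n ω‖)) atTop 0 := by
  obtain ⟨c, hc⟩ := hf.exists_integral_norm_empiricalOperator_sq_le hg h horth
  set σ := ∫ ω, ‖f (past δ 0 ω)‖ ^ 2 ∂P
  set Δ : ℕ → Ω → H₁ →L[ℝ] H₂ := fun n ω =>
    empiricalOperator n (causal δ f l · ω) (causal δ g l · ω)
  have hΔ (n : ℕ) : MemLp (Δ n) 2 P := hf.memLp_empiricalOperator hg h l n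
  have hX (n : ℕ) : MemLp (causal δ f l n) 2 P := hf.memLp_two h l n
  refine tendstoInMeasure_zero_of_integral_norm_le
    (b := fun n => |m n / √n| * ((c + σ) / 2))
    (fun n => ((hΔ n).norm.integrable_mul (hX n).norm).const_mul _) ?_
    (by simpa only [abs_zero, zero_mul] using hm.tendsto_div_nhds_zero.abs.mul_const ((c + σ) / 2))
  filter_upwards [eventually_ge_atTop 1] with n hn
  have hn₀ : (0 : ℝ) < n := by positivity
  have hamgm (ω : Ω) : ‖m n * (‖Δ n ω‖ * ‖causal δ f l n ω‖)‖ ≤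
      |m n / √n| * ((n * ‖Δ n ω‖ ^ 2 + ‖causal δ f l n ω‖ ^ 2) / 2) := by
    have htwo := two_mul_le_add_sq (√n * ‖Δ n ω‖) ‖causal δ f l n ω‖
    rw [mul_pow, Real.sq_sqrt hn₀.le] at htwo
    calc ‖m n * (‖Δ n ω‖ * ‖causal δ f l n ω‖)‖
        = |m n / √n| * (√n * ‖Δ n ω‖ * ‖causal δ f l n ω‖) := by
          rw [Real.norm_eq_abs, abs_mul, abs_of_nonneg (by positivity : 0 ≤ ‖Δ n ω‖ * _), abs_div,
            abs_of_nonneg (Real.sqrt_nonneg (n : ℝ))]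
          field_simp
      _ ≤ _ := by gcongr; linarith
  have hΔsq : Integrable (fun ω => (n : ℝ) * ‖Δ n ω‖ ^ 2) P :=
    ((hΔ n).integrable_norm_pow two_ne_zero).const_mul _
  have hXsq : Integrable (fun ω => ‖causal δ f l n ω‖ ^ 2) P :=
    (hX n).integrable_norm_pow two_ne_zero
  refine (integral_mono (((hΔ n).norm.integrable_mul (hX n).norm).const_mul _).norm
    (((hΔsq.add hXsq).div_const 2).const_mul _) hamgm).trans ?_
  simp only [Pi.add_apply]
  rw [integral_const_mul, integral_div, integral_add hΔsq hXsq, integral_const_mul,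
    hf.integral_norm_causal_sq h]
  have hcn : n * ∫ ω, ‖Δ n ω‖ ^ 2 ∂P ≤ c := by
    calc n * ∫ ω, ‖Δ n ω‖ ^ 2 ∂P ≤ n * (c * (n : ℝ)⁻¹) := by gcongr; exact hc l n
      _ = c := by field_simp
  gcongr

end MeanSquareRates

section Prediction

theorem empiricalOperator_congr {H₁ H₂ : Type*} [NormedAddCommGroup H₁] [InnerProductSpace ℝ H₁]
    [NormedAddCommGroup H₂] [InnerProductSpace ℝ H₂] {n : ℕ} {x x' : ℕ → H₁} {y y' : ℕ → H₂}
    (hx : ∀ k, 1 ≤ k → x k = x' k) (hy : ∀ k, 1 ≤ k → y k = y' k) :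
    empiricalOperator n x y = empiricalOperator n x' y' := by
  rw [empiricalOperator, empiricalOperator]
  refine congrArg _ (Finset.sum_congr rfl fun k hk => ?_)
  rw [hx k (Finset.mem_Icc.1 hk).1, hy k (Finset.mem_Icc.1 hk).1]

variable {Ω S : Type*} [MeasurableSpace Ω] {P : Measure Ω} [IsProbabilityMeasure P]
  [MeasurableSpace S] {δ : ℤ → Ω → S}
  {H₁ : Type*} [NormedAddCommGroup H₁] [InnerProductSpace ℝ H₁] [CompleteSpace H₁]
  [SecondCountableTopology H₁] {f : (ℕ → S) → H₁} {l : ℤ}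

theorem IsMApproximable.exists_finset_measure_le_norm_sub_secondMoment
    (hf : IsMApproximable P 4 δ f) (h : IsIID P δ) {ρ : ℝ} (hρ : 0 < ρ) {η : ENNReal}
    (hη : 0 < η) : ∃ D : Finset H₁, ∀ (l : ℤ) (k : ℕ), P {ω | ∀ d ∈ D,
      ρ ≤ ‖causal δ f l k ω - secondMoment P (fun ω => f (past δ 0 ω)) d‖} ≤ η := by
  set C := secondMoment P (fun ω => f (past δ 0 ω))
  obtain ⟨D, hD⟩ := FunctionalRegression.exists_finset_measure_le_norm_sub_secondMoment
    (hf.memLp.mono_exponent (by norm_num)) hρ hη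
  have hmeas : MeasurableSet {s | ∀ d ∈ D, ρ ≤ ‖f s - C d‖} := by
    simp only [Set.ofPred_forall]
    exact Finset.measurableSet_biInter _ fun d _ => measurableSet_le measurable_const
      (hf.stronglyMeasurable.sub stronglyMeasurable_const).norm.measurable
  exact ⟨D, fun l k => ((h.identDistrib_past (k + l) 0).measure_mem_eq hmeas).le.trans hD⟩

theorem IsMApproximable.ae_causal_eq_zero (hf : IsMApproximable P 4 δ f) (h : IsIID P δ)
    (hC : secondMoment P (fun ω => f (past δ 0 ω)) = 0) (l : ℤ) (k : ℕ) :
    ∀ᵐ ω ∂P, causal δ f l k ω = 0 := by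
  have hzero : ∀ᵐ ω ∂P, f (past δ 0 ω) = 0 := by
    filter_upwards [ae_mem_closure_range_secondMoment (hf.memLp.mono_exponent (q := 4) (p := 2)
      (by norm_num))] with ω hω
    rw [hC] at hω
    simpa [Set.range_zero] using hω
  exact (h.identDistrib_past 0 (k + l)).ae_snd (p := fun s => f s = 0)
    (hf.stronglyMeasurable.measurableSet_eq_fun stronglyMeasurable_const) hzero

variable {lam : ℕ → Ω → ℕ → ℝ} {v : ℕ → Ω → ℕ → H₁} {m : ℕ → ℝ}

theorem IsMApproximable.tendstoInMeasure_sub_principalProj (hf : IsMApproximable P 4 δ f)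
    (h : IsIID P δ) (hm : Tendsto m atTop atTop)
    (heig : ∀ᶠ n in atTop, ∀ᵐ ω ∂P, IsEigensystem
      (empiricalOperator n (causal δ f l · ω) (causal δ f l · ω)) (lam n ω) (v n ω)) :
    TendstoInMeasure P (fun n ω => causal δ f l n ω -
      principalProj (truncationLevel n (m n) (lam n ω)) (v n ω) (causal δ f l n ω)) atTop 0 := by
  set C := secondMoment P (fun ω => f (past δ 0 ω))
  set Q : ℕ → Ω → ℝ := fun n ω => ((n : ℝ)⁻¹ * ∑ k ∈ Finset.Icc 1 n, ‖causal δ f l k ω‖ ^ 2) / m n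
  set R : H₁ → ℕ → Ω → H₁ := fun d n ω =>
    empiricalOperator n (causal δ f l · ω) (causal δ f l · ω) d - C d
  have hG (d : H₁) : TendstoInMeasure P (fun n ω => ‖R d n ω‖ + Q n ω * ‖d‖) atTop 0 :=
    tendstoInMeasure_zero_of_norm_le_add
      (hf.tendstoInMeasure_empiricalOperator_apply h l d)
      (hf.tendstoInMeasure_div_average_norm_sq h l hm) zero_le_one (norm_nonneg d)
      (Eventually.of_forall fun n => ae_of_all _ fun ω => by
        refine (norm_add_le _ _).trans_eq ?_
        rw [norm_norm, norm_mul, norm_norm, one_mul, mul_comm ‖d‖])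
  refine tendstoInMeasure_zero_of_finset hG fun ε hε η hη => ?_
  obtain ⟨D, hD⟩ := hf.exists_finset_measure_le_norm_sub_secondMoment h (half_pos hε) hη
  refine ⟨D, _, hD l, ε / 2, half_pos hε, ?_⟩
  filter_upwards [heig, hm.eventually_gt_atTop 0] with n heig hmn
  filter_upwards [heig] with ω heig hnear hsmall
  obtain ⟨d, hd, hdist⟩ : ∃ d ∈ D, ‖causal δ f l n ω - C d‖ < ε / 2 := by
    simpa only [Set.mem_ofPred_eq, not_forall, not_le, exists_prop] using hnear
  have hQ : lam n ω 1 / m n ≤ Q n ω := div_le_div_of_nonneg_right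
    (heig.le_opNorm.trans (norm_empiricalOperator_self_le n _)) hmn.le
  calc ‖causal δ f l n ω -
        principalProj (truncationLevel n (m n) (lam n ω)) (v n ω) (causal δ f l n ω)‖
      ≤ ‖causal δ f l n ω - C d‖ + ‖R d n ω‖ + lam n ω 1 / m n * ‖d‖ :=
        heig.norm_sub_principalProj_truncationLevel_le hmn _ _ d
    _ ≤ ‖causal δ f l n ω - C d‖ + (‖R d n ω‖ + Q n ω * ‖d‖) := by
        rw [add_assoc]
        gcongr
    _ < ε / 2 + ε / 2 := add_lt_add hdist ((le_abs_self _).trans_lt (hsmall d hd))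
    _ = ε := add_halves ε

variable {H₂ : Type*} [NormedAddCommGroup H₂] [InnerProductSpace ℝ H₂] [CompleteSpace H₂]
  {g : (ℕ → S) → H₂}

theorem IsMApproximable.tendstoInMeasure_empiricalOperator_truncatedInverse
    (hf : IsMApproximable P 4 δ f) (hg : IsMApproximable P 4 δ g) (h : IsIID P δ)
    (horth : ∫ ω, tensor (f (past δ 0 ω)) (g (past δ 0 ω)) ∂P = 0)
    (hm : Tendsto m atTop atTop) (hmo : m =o[atTop] fun n : ℕ => √n)
    (heig : ∀ᶠ n in atTop, ∀ᵐ ω ∂P, IsEigensystem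
      (empiricalOperator n (causal δ f l · ω) (causal δ f l · ω)) (lam n ω) (v n ω)) :
    TendstoInMeasure P (fun n ω => empiricalOperator n (causal δ f l · ω) (causal δ g l · ω)
      (truncatedInverse (truncationLevel n (m n) (lam n ω)) (lam n ω) (v n ω)
        (causal δ f l n ω))) atTop 0 := by
  have hR (d : H₁) := hf.tendstoInMeasure_empiricalOperator_apply h l d
  set C := secondMoment P (fun ω => f (past δ 0 ω))
  by_cases hdeg : ∀ d, C d = 0
  · have hzero (n : ℕ) : ∀ᵐ ω ∂P, causal δ f l n ω = 0 :=
      hf.ae_causal_eq_zero h (ContinuousLinearMap.ext hdeg) l n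
    refine tendstoInMeasure_zero_of_norm_lt (hR 0) (hR 0) fun ε hε => ⟨1, one_pos, ?_⟩
    refine Eventually.of_forall fun n => ?_
    filter_upwards [hzero n] with ω hω _ _
    simpa [hω, truncatedInverse] using hε
  · obtain ⟨d, hd⟩ := not_forall.1 hdeg
    have hd₀ : d ≠ 0 := by rintro rfl; exact hd (map_zero C)
    set κ := ‖C d‖ / 2
    have hκ : 0 < κ := half_pos (norm_pos_iff.2 hd)
    have hτ : 0 < κ / ‖d‖ := div_pos hκ (norm_pos_iff.2 hd₀)
    refine tendstoInMeasure_zero_of_norm_lt (hR d)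
      (hf.tendstoInMeasure_mul_norm_empiricalOperator hg h horth l hmo) fun ε hε =>
      ⟨min κ (κ / ‖d‖ * ε), lt_min hκ (mul_pos hτ hε), ?_⟩
    filter_upwards [heig, hm.eventually_ge_atTop 0] with n heig hmn
    filter_upwards [heig] with ω heig hRd hprod
    have hlam : κ / ‖d‖ ≤ lam n ω 1 := by
      rw [div_le_iff₀ (norm_pos_iff.2 hd₀)]
      refine le_trans ?_ (heig.norm_apply_le d)
      have hCd := norm_le_norm_add_norm_sub
        (empiricalOperator n (causal δ f l · ω) (causal δ f l · ω) d) (C d)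
      have hκκ : κ + κ = ‖C d‖ := add_halves _
      linarith [hRd.trans_le (min_le_left _ _)]
    have hprod' : m n * (‖empiricalOperator n (causal δ f l · ω) (causal δ g l · ω)‖ *
        ‖causal δ f l n ω‖) < κ / ‖d‖ * ε :=
      (le_abs_self _).trans_lt (hprod.trans_le (min_le_right _ _))
    calc ‖empiricalOperator n (causal δ f l · ω) (causal δ g l · ω) (truncatedInverse
          (truncationLevel n (m n) (lam n ω)) (lam n ω) (v n ω) (causal δ f l n ω))‖
        ≤ ‖empiricalOperator n (causal δ f l · ω) (causal δ g l · ω)‖ *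
          (m n / (κ / ‖d‖) * ‖causal δ f l n ω‖) := by
          refine ContinuousLinearMap.le_opNorm_of_le _ ?_
          refine (heig.norm_truncatedInverse_truncationLevel_le hmn _).trans ?_
          gcongr
      _ = m n * (‖empiricalOperator n (causal δ f l · ω) (causal δ g l · ω)‖ *
          ‖causal δ f l n ω‖) / (κ / ‖d‖) := by ring
      _ < ε := (div_lt_iff₀' hτ).2 hprod'

theorem IsMApproximable.tendstoInMeasure_sub_pcEstimator
    (hf : IsMApproximable P 4 δ f) (hg : IsMApproximable P 4 δ g) (h : IsIID P δ)
    (horth : ∫ ω, tensor (f (past δ 0 ω)) (g (past δ 0 ω)) ∂P = 0)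
    {Ψ : H₁ →L[ℝ] H₂} {X : ℕ → Ω → H₁} {Y : ℕ → Ω → H₂}
    (hX : ∀ k : ℕ, 1 ≤ k → X k =ᵐ[P] causal δ f l k)
    (hY : ∀ k : ℕ, 1 ≤ k → ∀ᵐ ω ∂P, Y k ω = Ψ (X k ω) + causal δ g l k ω)
    (hm : Tendsto m atTop atTop) (hmo : m =o[atTop] fun n : ℕ => √n)
    (heig : ∀ᶠ n in atTop, ∀ᵐ ω ∂P,
      IsEigensystem (empiricalOperator n (X · ω) (X · ω)) (lam n ω) (v n ω)) :
    TendstoInMeasure P (fun n ω => Ψ (X n ω) -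
      pcEstimator n (truncationLevel n (m n) (lam n ω)) (X · ω) (Y · ω) (lam n ω) (v n ω)
        (X n ω)) atTop 0 := by
  have hXae : ∀ᵐ ω ∂P, ∀ k : ℕ, 1 ≤ k → X k ω = causal δ f l k ω :=
    ae_all_iff.2 fun k => ae_all_iff.2 (hX k)
  have hYae : ∀ᵐ ω ∂P, ∀ k : ℕ, 1 ≤ k → Y k ω = Ψ (X k ω) + causal δ g l k ω :=
    ae_all_iff.2 fun k => ae_all_iff.2 (hY k)
  have heig' : ∀ᶠ n in atTop, ∀ᵐ ω ∂P, IsEigensystem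
      (empiricalOperator n (causal δ f l · ω) (causal δ f l · ω)) (lam n ω) (v n ω) := by
    filter_upwards [heig] with n heig
    filter_upwards [heig, hXae] with ω heig hX
    rwa [← empiricalOperator_congr hX hX]
  refine tendstoInMeasure_zero_of_norm_le_add
    (hf.tendstoInMeasure_sub_principalProj h hm heig')
    (hf.tendstoInMeasure_empiricalOperator_truncatedInverse hg h horth hm hmo heig')
    (norm_nonneg Ψ) zero_le_one ?_
  filter_upwards [heig, eventually_ge_atTop 1] with n heig hn
  filter_upwards [heig, hXae, hYae] with ω heig hX hY
  rw [one_mul, ← hX n hn, ← empiricalOperator_congr (y := (causal δ g l · ω)) hX fun _ _ => rfl]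
  exact heig.norm_sub_pcEstimator_le hY (m n) (X n ω)

end Prediction

section AutoregressivePrediction

variable {Ω : Type*} [MeasurableSpace Ω] {P : Measure Ω} [IsProbabilityMeasure P]
  {H : Type u} [NormedAddCommGroup H] [InnerProductSpace ℝ H] [CompleteSpace H]
  [SecondCountableTopology H] [MeasurableSpace H] [OpensMeasurableSpace H]

theorem IsLpMApproximable.tendstoInMeasure_sub_pcEstimator_succ {X : ℕ → Ω → H}
    (hX : IsLpMApproximable P 4 X) {Ψ : H →L[ℝ] H}
    (horth : ∫ ω, tensor (X 1 ω) (X 2 ω - Ψ (X 1 ω)) ∂P = 0) {m : ℕ → ℝ}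
    (hm : Tendsto m atTop atTop) (hmo : m =o[atTop] fun n : ℕ => √n)
    {lam : ℕ → Ω → ℕ → ℝ} {v : ℕ → Ω → ℕ → H} (heig : ∀ᶠ n in atTop, ∀ᵐ ω ∂P,
      IsEigensystem (empiricalOperator n (X · ω) (X · ω)) (lam n ω) (v n ω)) :
    TendstoInMeasure P (fun n ω => Ψ (X n ω) -
      pcEstimator n (truncationLevel n (m n) (lam n ω)) (X · ω) (fun k => X (k + 1) ω) (lam n ω)
        (v n ω) (X n ω)) atTop 0 := by
  obtain ⟨S, _, δ, u, h, hu, hrep⟩ := hX.exists_isMApproximable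
  -- Both `X k` and `X (k + 1) - Ψ (X k)` are functions of `past δ (k + 1)`.
  set f : (ℕ → S) → H := fun s => u fun i => s (i + 1)
  set g : (ℕ → S) → H := fun s => u s - Ψ (f s)
  have hf : IsMApproximable P 4 δ f := hu.tail h
  have hg : IsMApproximable P 4 δ g := hu.sub (hf.clm Ψ) h (by norm_num)
  have hXf (k : ℕ) (hk : 1 ≤ k) : X k =ᵐ[P] causal δ f 1 k := by
    filter_upwards [hrep k hk] with ω hω
    rw [hω, ← past_tail δ k 1 ω]
    rfl
  have hXg (k : ℕ) (hk : 1 ≤ k) : ∀ᵐ ω ∂P, X (k + 1) ω = Ψ (X k ω) + causal δ g 1 k ω := by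
    filter_upwards [hXf k hk, hrep (k + 1) (by omega)] with ω hfω huω
    rw [hfω, huω, Nat.cast_add, Nat.cast_one]
    exact (add_sub_cancel _ _).symm
  have hfg : StronglyMeasurable fun s => tensor (f s) (g s) :=
    (InnerProductSpace.rankOne ℝ : H →L[ℝ] H →L[ℝ] H →L[ℝ] H).continuous₂.comp_stronglyMeasurable
      (hg.stronglyMeasurable.prodMk hf.stronglyMeasurable)
  have horth₀ : ∫ ω, tensor (f (past δ 0 ω)) (g (past δ 0 ω)) ∂P = 0 := by
    rw [integral_comp_eq_of_identDistrib (f := fun s => tensor (f s) (g s))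
      (h.identDistrib_past 0 ((1 : ℕ) + 1)) hfg, ← horth]
    refine integral_congr_ae ?_
    filter_upwards [hXf 1 le_rfl, hXg 1 le_rfl] with ω hfω hgω
    rw [hgω, add_sub_cancel_left, hfω]
    rfl
  exact hf.tendstoInMeasure_sub_pcEstimator hg h horth₀ hXf hXg hm hmo heig

end AutoregressivePrediction

section CausalSeries

theorem coupledPast_add {Ω S : Type*} (δ : ℤ → Ω → S) (m : ℕ) (q : Ω × Ω) :
    (fun j => coupledPast δ m q (j + m)) = past δ 0 q.2 := by
  funext j
  simp [coupledPast, past]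

variable {E : Type*} [NormedAddCommGroup E] [NormedSpace ℝ E]

/-- The value `∑_j Ψ^j s_j` at `s = (ε_k, ε_{k-1}, …)` of the causal solution of the autoregressive
recursion. It is `0` where the series diverges. -/
def causalSeries (Ψ : E →L[ℝ] E) (s : ℕ → E) : E := ∑' j, (Ψ ^ j) (s j)

theorem causalSeries_eq_sum_add (Ψ : E →L[ℝ] E) {s t : ℕ → E} (m : ℕ)
    (hst : (fun j => s (j + m)) = t) (ht : Summable fun j => (Ψ ^ j) (t j)) :
    causalSeries Ψ s = ∑ j ∈ Finset.range m, (Ψ ^ j) (s j) + (Ψ ^ m) (causalSeries Ψ t) := by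
  subst hst
  have hshift (j : ℕ) : (Ψ ^ (j + m)) (s (j + m)) = (Ψ ^ m) ((Ψ ^ j) (s (j + m))) := by
    rw [add_comm j m, pow_add]
    rfl
  have hs : Summable fun j => (Ψ ^ j) (s j) := by
    rw [← summable_nat_add_iff m]
    simpa only [hshift] using ht.mapL (Ψ ^ m)
  rw [causalSeries, ← hs.sum_add_tsum_nat_add m, causalSeries, (Ψ ^ m).map_tsum ht]
  simp only [hshift]

variable {Ω : Type*} [MeasurableSpace Ω] {P : Measure Ω} {p : ENNReal}

variable [MeasurableSpace E] [BorelSpace E] {Ψ : E →L[ℝ] E} {δ : ℤ → Ω → E}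

theorem tsum_eLpNorm_pow_past_ne_top (h : IsIID P δ) (hΨ : Summable fun n => ‖Ψ ^ n‖)
    (hδ : MemLp (δ 0) p P) (k : ℤ) :
    ∑' j, eLpNorm (fun ω => (Ψ ^ j) (past δ k ω j)) p P ≠ ⊤ := by
  refine ne_top_of_le_ne_top ?_ (ENNReal.tsum_le_tsum fun j =>
    (eLpNorm_clm_le (Ψ ^ j) fun ω => past δ k ω j).trans_eq
      (congrArg (‖Ψ ^ j‖ₑ * ·) ((h.identDistrib (k - j) 0).eLpNorm_eq p)))
  rw [ENNReal.tsum_mul_right]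
  exact ENNReal.mul_ne_top (tsum_enorm_ne_top_iff_summable_norm.2 hΨ) hδ.2.ne

variable [SecondCountableTopology E]

theorem aestronglyMeasurable_pow_past (h : IsIID P δ) (Ψ : E →L[ℝ] E) (k : ℤ) (j : ℕ) :
    AEStronglyMeasurable (fun ω => (Ψ ^ j) (past δ k ω j)) P :=
  (Ψ ^ j).continuous.comp_aestronglyMeasurable (h.measurable _).aestronglyMeasurable

variable [CompleteSpace E]

theorem measurable_causalSeries (Ψ : E →L[ℝ] E) : Measurable (causalSeries Ψ) :=
  Measurable.tsum fun j => (Ψ ^ j).continuous.measurable.comp (measurable_pi_apply j)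

theorem ae_summable_pow_past (h : IsIID P δ) (hΨ : Summable fun n => ‖Ψ ^ n‖) (hp : 1 ≤ p)
    (hδ : MemLp (δ 0) p P) (k : ℤ) : ∀ᵐ ω ∂P, Summable fun j => (Ψ ^ j) (past δ k ω j) := by
  filter_upwards [summable_norm_of_tsum_eLpNorm_ne_top hp (aestronglyMeasurable_pow_past h Ψ k)
    (tsum_eLpNorm_pow_past_ne_top h hΨ hδ k)] with ω hω
  exact hω.of_norm

theorem memLp_causalSeries (h : IsIID P δ) (hΨ : Summable fun n => ‖Ψ ^ n‖) (hp : 1 ≤ p)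
    (hδ : MemLp (δ 0) p P) (k : ℤ) : MemLp (fun ω => causalSeries Ψ (past δ k ω)) p P := by
  have hmeas := aestronglyMeasurable_pow_past h Ψ k
  refine ⟨((measurable_causalSeries Ψ).comp (h.measurable_past k)).aestronglyMeasurable,
    lt_of_le_of_lt ?_ (tsum_eLpNorm_pow_past_ne_top h hΨ hδ k).lt_top⟩
  refine Lp.eLpNorm_le_of_ae_tendsto (u := atTop)
    (f := fun n => ∑ j ∈ Finset.range n, fun ω => (Ψ ^ j) (past δ k ω j))
    (Eventually.of_forall fun n => (eLpNorm_sum_le (fun j _ => hmeas j) hp).trans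
      (ENNReal.sum_le_tsum _))
    (fun n => Finset.aestronglyMeasurable_sum _ fun j _ => hmeas j) ?_
  filter_upwards [ae_summable_pow_past h hΨ hp hδ k] with ω hω
  simpa only [Finset.sum_apply, causalSeries] using hω.hasSum.tendsto_sum_nat

variable [IsProbabilityMeasure P]

-- Coupling at `m` leaves the first `m` terms of the series alone, so the factor `Ψ^m` comes out.
theorem couplingError_causalSeries_le (h : IsIID P δ) (hΨ : Summable fun n => ‖Ψ ^ n‖)
    (hp : 1 ≤ p) (hδ : MemLp (δ 0) p P) (m : ℕ) :
    couplingError P p δ (causalSeries Ψ) m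
      ≤ ‖Ψ ^ m‖ₑ * (2 * eLpNorm (fun ω => causalSeries Ψ (past δ 0 ω)) p P) := by
  have hsum := ae_summable_pow_past h hΨ hp hδ 0
  have hmem := memLp_causalSeries h hΨ hp hδ 0
  have hdiff : (fun q : Ω × Ω =>
      causalSeries Ψ (past δ m q.1) - causalSeries Ψ (coupledPast δ m q)) =ᵐ[P.prod P]
        fun q => (Ψ ^ m) (causalSeries Ψ (past δ 0 q.1) - causalSeries Ψ (past δ 0 q.2)) := by
    filter_upwards [Measure.quasiMeasurePreserving_fst.ae hsum,
      Measure.quasiMeasurePreserving_snd.ae hsum] with q hfst hsnd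
    have hinit : ∑ j ∈ Finset.range m, (Ψ ^ j) (coupledPast δ m q j)
        = ∑ j ∈ Finset.range m, (Ψ ^ j) (past δ m q.1 j) :=
      Finset.sum_congr rfl fun j hj => by
        rw [coupledPast, if_pos (Finset.mem_range.1 hj), past]
    have htail : (fun j => past δ m q.1 (j + m)) = past δ 0 q.1 := by
      simpa only [zero_add] using past_tail δ 0 m q.1
    rw [causalSeries_eq_sum_add Ψ m htail hfst,
      causalSeries_eq_sum_add Ψ m (coupledPast_add δ m q) hsnd, hinit, add_sub_add_left_eq_sub,
      map_sub]
  calc couplingError P p δ (causalSeries Ψ) m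
      = eLpNorm (fun q : Ω × Ω => (Ψ ^ m) (causalSeries Ψ (past δ 0 q.1) -
          causalSeries Ψ (past δ 0 q.2))) p (P.prod P) := eLpNorm_congr_ae hdiff
    _ ≤ ‖Ψ ^ m‖ₑ * eLpNorm (fun q : Ω × Ω => causalSeries Ψ (past δ 0 q.1) -
          causalSeries Ψ (past δ 0 q.2)) p (P.prod P) := eLpNorm_clm_le _ _
    _ ≤ ‖Ψ ^ m‖ₑ * (eLpNorm (fun ω => causalSeries Ψ (past δ 0 ω)) p P +
          eLpNorm (fun ω => causalSeries Ψ (past δ 0 ω)) p P) := by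
        gcongr
        refine (eLpNorm_sub_le (hmem.comp_fst P).1 (hmem.comp_snd P).1 hp).trans_eq ?_
        have hmeas := (measurable_causalSeries Ψ).stronglyMeasurable
        exact congrArg₂ (· + ·)
          (eLpNorm_comp_eq_of_identDistrib (identDistrib_fst (h.measurable_past 0)) hmeas p)
          (eLpNorm_comp_eq_of_identDistrib (identDistrib_snd (h.measurable_past 0)) hmeas p)
    _ = _ := by rw [two_mul]

theorem isMApproximable_causalSeries (h : IsIID P δ) (hΨ : Summable fun n => ‖Ψ ^ n‖)
    (hp : 1 ≤ p) (hδ : MemLp (δ 0) p P) : IsMApproximable P p δ (causalSeries Ψ) where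
  stronglyMeasurable := (measurable_causalSeries Ψ).stronglyMeasurable
  memLp := memLp_causalSeries h hΨ hp hδ 0
  tsum_ne_top := by
    refine ne_top_of_le_ne_top ?_ (ENNReal.tsum_le_tsum fun m =>
      couplingError_causalSeries_le h hΨ hp hδ m)
    rw [ENNReal.tsum_mul_right]
    exact ENNReal.mul_ne_top (tsum_enorm_ne_top_iff_summable_norm.2 hΨ)
      (ENNReal.mul_ne_top ENNReal.ofNat_ne_top (memLp_causalSeries h hΨ hp hδ 0).2.ne)

end CausalSeries

section StationarySolution

variable {Ω : Type*} [MeasurableSpace Ω] {P : Measure Ω}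

theorem tendstoInMeasure_mul_of_identDistrib [IsFiniteMeasure P] {Z : ℕ → Ω → ℝ} {Z₀ : Ω → ℝ}
    (hZ : ∀ n, IdentDistrib (Z n) Z₀ P P) {a : ℕ → ℝ} (ha : Tendsto a atTop (𝓝 0)) :
    TendstoInMeasure P (fun n ω => a n * Z n ω) atTop 0 := by
  have hZ₀ : AEMeasurable Z₀ P := (hZ 0).aemeasurable_snd
  have hlim : TendstoInMeasure P (fun n ω => a n * Z₀ ω) atTop 0 :=
    tendstoInMeasure_of_tendsto_ae (fun n => (hZ₀.const_mul _).aestronglyMeasurable)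
      (ae_of_all _ fun ω => by
        simpa only [zero_mul, Pi.zero_apply] using ha.mul_const (Z₀ ω))
  rw [tendstoInMeasure_iff_norm] at hlim ⊢
  intro ρ hρ
  refine (hlim ρ hρ).congr fun n => ?_
  have hset : MeasurableSet {x : ℝ | ρ ≤ ‖a n * x - 0‖} :=
    (isClosed_le continuous_const (by fun_prop)).measurableSet
  exact ((hZ n).measure_mem_eq hset).symm

variable {E : Type*} [NormedAddCommGroup E] [NormedSpace ℝ E] {Ψ : E →L[ℝ] E}

theorem eq_zero_of_apply_eq_self (hΨ : Tendsto (fun n => ‖Ψ ^ n‖) atTop (𝓝 0)) {x : E}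
    (hx : Ψ x = x) : x = 0 := by
  have hpow (n : ℕ) : (Ψ ^ n) x = x := by
    rw [FunLike.coe_pow_eq_iterate]
    exact Function.IsFixedPt.iterate hx n
  have hle (n : ℕ) : ‖x‖ ≤ ‖Ψ ^ n‖ * ‖x‖ := by
    simpa only [hpow] using (Ψ ^ n).le_opNorm x
  have hlim : Tendsto (fun n => ‖Ψ ^ n‖ * ‖x‖) atTop (𝓝 0) := by
    simpa only [zero_mul] using hΨ.mul_const ‖x‖
  exact norm_le_zero_iff.1 (ge_of_tendsto' hlim hle)

theorem ae_sub_eq_pow_apply_sub {X Y ε : ℤ → Ω → E}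
    (hX : ∀ k, ∀ᵐ ω ∂P, X (k + 1) ω = Ψ (X k ω) + ε (k + 1) ω)
    (hY : ∀ k, ∀ᵐ ω ∂P, Y (k + 1) ω = Ψ (Y k ω) + ε (k + 1) ω) (n : ℕ) (k : ℤ) :
    ∀ᵐ ω ∂P, X k ω - Y k ω = (Ψ ^ n) (X (k - n) ω - Y (k - n) ω) := by
  induction n with
  | zero => simp
  | succ n ih =>
    filter_upwards [ih, hX (k - (n + 1 : ℕ)), hY (k - (n + 1 : ℕ))] with ω hω hXω hYω
    rw [show k - ((n + 1 : ℕ) : ℤ) + 1 = k - n by push_cast; ring] at hXω hYω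
    rw [hω, hXω, hYω, add_sub_add_right_eq_sub, ← map_sub, pow_succ]
    rfl

theorem ae_eq_of_recurrence [MeasurableSpace E] [OpensMeasurableSpace E] [IsFiniteMeasure P]
    (hΨ : Tendsto (fun n => ‖Ψ ^ n‖) atTop (𝓝 0)) {X Y ε : ℤ → Ω → E}
    (hXdist : ∀ k, IdentDistrib (X k) (X 0) P P) (hYdist : ∀ k, IdentDistrib (Y k) (Y 0) P P)
    (hX : ∀ k, ∀ᵐ ω ∂P, X (k + 1) ω = Ψ (X k ω) + ε (k + 1) ω)
    (hY : ∀ k, ∀ᵐ ω ∂P, Y (k + 1) ω = Ψ (Y k ω) + ε (k + 1) ω) (k : ℤ) : X k =ᵐ[P] Y k := by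
  have hlim : TendstoInMeasure P (fun _ : ℕ => X k - Y k) atTop 0 := by
    refine tendstoInMeasure_zero_of_norm_le_add
      (tendstoInMeasure_mul_of_identDistrib (fun n : ℕ => (hXdist (k - n)).norm) hΨ)
      (tendstoInMeasure_mul_of_identDistrib (fun n : ℕ => (hYdist (k - n)).norm) hΨ)
      zero_le_one zero_le_one (Eventually.of_forall fun n => ?_)
    filter_upwards [ae_sub_eq_pow_apply_sub hX hY n k] with ω hω
    simp only [one_mul, norm_mul, norm_norm, ← mul_add]
    rw [Pi.sub_apply, hω]
    exact ((Ψ ^ n).le_opNorm _).trans (by gcongr; exact norm_sub_le _ _)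
  have hconst : TendstoInMeasure P (fun _ : ℕ => X k - Y k) atTop (X k - Y k) := by
    intro ε hε
    simp [hε.not_ge]
  filter_upwards [tendstoInMeasure_ae_unique hconst hlim] with ω hω
  exact sub_eq_zero.1 hω

variable [MeasurableSpace E] [BorelSpace E]

theorem integral_eq_zero_of_recurrence [CompleteSpace E]
    (hΨ : Tendsto (fun n => ‖Ψ ^ n‖) atTop (𝓝 0)) {X Y e : Ω → E} (hX : Integrable X P)
    (he : Integrable e P) (h0 : ∫ ω, e ω ∂P = 0) (hXY : IdentDistrib Y X P P)
    (hrec : ∀ᵐ ω ∂P, Y ω = Ψ (X ω) + e ω) : ∫ ω, X ω ∂P = 0 := by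
  refine eq_zero_of_apply_eq_self hΨ ?_
  calc
    Ψ (∫ ω, X ω ∂P) = ∫ ω, (Ψ (X ω) + e ω) ∂P := by
      rw [integral_add (Ψ.integrable_comp hX) he, h0, add_zero, Ψ.integral_comp_comm hX]
    _ = ∫ ω, Y ω ∂P := (integral_congr_ae hrec).symm
    _ = ∫ ω, X ω ∂P := hXY.integral_eq

variable [SecondCountableTopology E] [CompleteSpace E] {δ : ℤ → Ω → E}

theorem ae_eq_causalSeries [IsProbabilityMeasure P] {p : ENNReal} (h : IsIID P δ)
    (hΨ : Summable fun n => ‖Ψ ^ n‖) (hp : 1 ≤ p) (hδ : MemLp (δ 0) p P) {X : ℤ → Ω → E}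
    (hX : ∀ k, IdentDistrib (X k) (X 0) P P)
    (hrec : ∀ k, ∀ᵐ ω ∂P, X (k + 1) ω = Ψ (X k ω) + δ (k + 1) ω) (k : ℤ) :
    X k =ᵐ[P] fun ω => causalSeries Ψ (past δ k ω) := by
  refine ae_eq_of_recurrence (Y := fun k ω => causalSeries Ψ (past δ k ω))
    hΨ.tendsto_atTop_zero hX
    (fun k => (h.identDistrib_past k 0).comp (measurable_causalSeries Ψ)) hrec (fun k => ?_) k
  filter_upwards [ae_summable_pow_past h hΨ hp hδ k] with ω hω
  rw [causalSeries_eq_sum_add Ψ 1 (by simpa using past_tail δ k 1 ω) hω]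
  simp [past, add_comm]

theorem IsIID.isLpMApproximable {E : Type u} [NormedAddCommGroup E] [MeasurableSpace E]
    {p : ENNReal} {δ : ℤ → Ω → E} (h : IsIID P δ) {e : ℕ → Ω → E}
    (hp : ∀ n, 1 ≤ n → MemLp (e n) p P) (he : ∀ n : ℕ, 1 ≤ n → e n =ᵐ[P] δ n) :
    IsLpMApproximable P p e :=
  ⟨hp, E, _, δ, fun s => s 0, h.measurable, h.indep, fun i => h.identDistrib i 0,
    measurable_pi_apply 0, fun n hn => by simpa using he n hn, by simp [couplingError]⟩

end StationarySolution

section AssumptionA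

variable {Ω : Type*} [MeasurableSpace Ω] {P : Measure Ω} {H : Type u} [NormedAddCommGroup H]
  [InnerProductSpace ℝ H] [MeasurableSpace H] [BorelSpace H]

theorem covOperator_eq_of_identDistrib [SecondCountableTopology H] {X Y : Ω → H}
    (h : IdentDistrib X Y P P) : covOperator P X = covOperator P Y := by
  have hmeas : StronglyMeasurable fun x : H =>
      tensor (x - ∫ ω, Y ω ∂P) (x - ∫ ω, Y ω ∂P) := by
    have hcont : Continuous fun x : H => x - ∫ ω, Y ω ∂P := by fun_prop
    exact (InnerProductSpace.rankOne ℝ : H →L[ℝ] H →L[ℝ] H →L[ℝ] H).continuous₂.comp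
      (hcont.prodMk hcont) |>.stronglyMeasurable
  rw [covOperator, h.integral_eq]
  exact integral_comp_eq_of_identDistrib h hmeas

variable [CompleteSpace H]

theorem orthogonal_of_indepFun [IsFiniteMeasure P] {X Y : Ω → H} (hX : MemLp X 2 P)
    (hY : MemLp Y 2 P) (hXY : IndepFun X Y P) (h0 : ∫ ω, Y ω ∂P = 0) : Orthogonal P X Y := by
  refine ⟨hX, hY, ?_⟩
  have hbilin := hXY.symm.integral_bilin (hY.integrable one_le_two) (hX.integrable one_le_two)
    (InnerProductSpace.rankOne ℝ : H →L[ℝ] H →L[ℝ] H →L[ℝ] H)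
  rwa [h0, map_zero] at hbilin

theorem isWhiteNoise_of_iIndepFun [SecondCountableTopology H] [IsFiniteMeasure P]
    {e : ℕ → Ω → H} (hindep : iIndepFun e P) (hdist : ∀ j k, IdentDistrib (e j) (e k) P P)
    (he : ∀ k, MemLp (e k) 2 P) (h0 : ∀ k, ∫ ω, e k ω ∂P = 0) : IsWhiteNoise P e where
  memLp k _ := he k
  orthogonal j k _ _ hjk := orthogonal_of_indepFun (he j) (he k) (hindep.indepFun hjk) (h0 k)
  mean_const j k _ _ := (hdist j k).integral_eq
  cov_const j k _ _ := covOperator_eq_of_identDistrib (hdist j k)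

theorem assumptionA_of_recurrence [SecondCountableTopology H] [IsProbabilityMeasure P]
    {Ψ : H →L[ℝ] H} (hΨ : Summable fun n => ‖Ψ ^ n‖) {X ε : ℤ → Ω → H}
    (hX : ∀ k, IdentDistrib (X k) (X 0) P P)
    (hrec : ∀ k, ∀ᵐ ω ∂P, X (k + 1) ω = Ψ (X k ω) + ε (k + 1) ω) (hindep : iIndepFun ε P)
    (hdist : ∀ i, IdentDistrib (ε i) (ε 0) P P) (hε : ∀ i, MemLp (ε i) 4 P)
    (h0 : ∀ i, ∫ ω, ε i ω ∂P = 0) :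
    AssumptionA P (fun k : ℕ => X k) (fun k : ℕ => ε ((k : ℤ) + 1)) := by
  have hmeas (i : ℤ) : AEMeasurable (ε i) P := (hε i).1.aemeasurable
  set δ : ℤ → Ω → H := fun i => (hmeas i).mk
  have hεδ (i : ℤ) : ε i =ᵐ[P] δ i := (hmeas i).ae_eq_mk
  have hεdist (i j : ℤ) : IdentDistrib (ε i) (ε j) P P := (hdist i).trans (hdist j).symm
  have h : IsIID P δ := ⟨fun i => (hmeas i).measurable_mk, hindep.congr hεδ, fun i j =>
    ((IdentDistrib.of_ae_eq (hmeas i) (hεδ i)).symm.trans (hεdist i j)).trans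
      (IdentDistrib.of_ae_eq (hmeas j) (hεδ j))⟩
  have hδ : MemLp (δ 0) 4 P := (memLp_congr_ae (hεδ 0)).1 (hε 0)
  have hXδ : ∀ k, X k =ᵐ[P] fun ω => causalSeries Ψ (past δ k ω) :=
    ae_eq_causalSeries h hΨ (by norm_num) hδ hX fun k => by
      filter_upwards [hrec k, hεδ (k + 1)] with ω hω hεω
      rw [hω, hεω]
  have happrox := isMApproximable_causalSeries h hΨ (by norm_num) hδ
  have hX4 (k : ℤ) : MemLp (X k) 4 P := (memLp_congr_ae (hXδ k)).2 (happrox.memLp_past h k)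
  have hshift : IsIID P fun i : ℤ => δ (i + 1) :=
    ⟨fun i => h.measurable _, h.indep.precomp (add_left_injective 1), fun i j => h.identDistrib _ _⟩
  have hindepX (k : ℤ) : IndepFun (X k) (ε (k + 1)) P :=
    ((h.indepFun_past_succ k).comp (measurable_causalSeries Ψ) measurable_id).congr
      (hXδ k).symm (hεδ (k + 1)).symm
  have h42 {Z : Ω → H} (hZ : MemLp Z 4 P) : MemLp Z 2 P := hZ.mono_exponent (by norm_num)
  exact
    { mean_X := fun k _ => integral_eq_zero_of_recurrence hΨ.tendsto_atTop_zero
        ((hX4 k).integrable (by norm_num)) ((hε (k + 1)).integrable (by norm_num)) (h0 _)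
        ((hX _).trans (hX k).symm) (hrec k)
      mean_ε := fun k _ => h0 _
      approx_X := happrox.isLpMApproximable h fun n _ => hXδ n
      approx_ε := hshift.isLpMApproximable (fun n _ => hε _) fun n _ => hεδ _
      whiteNoise := isWhiteNoise_of_iIndepFun
        (hindep.precomp fun a b hab => by simpa using hab) (fun j k => hεdist _ _)
        (fun k => h42 (hε _)) fun k => h0 _
      orthogonal := fun k _ => orthogonal_of_indepFun (h42 (hX4 k)) (h42 (hε _)) (hindepX k)
        (h0 _) }

theorem IsStationaryARH1.identDistrib {H : Type*} [NormedAddCommGroup H] [InnerProductSpace ℝ H]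
    [MeasurableSpace H] {Ψ : H →L[ℝ] H} {X ε : ℤ → Ω → H} (hX : IsStationaryARH1 P Ψ X ε)
    (k : ℤ) : IdentDistrib (X k) (X 0) P P where
  aemeasurable_fst := hX.aemeasurable k
  aemeasurable_snd := hX.aemeasurable 0
  map_eq := by
    have hmap (h : ℤ) : (P.map fun ω j => X (j + h) ω).map (fun s : ℤ → H => s 0) =
        P.map (X h) := by
      rw [AEMeasurable.map_map_of_aemeasurable (measurable_pi_apply 0).aemeasurable
        (aemeasurable_pi_iff.2 fun j => hX.aemeasurable _)]
      simp only [Function.comp_def, zero_add]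
    simpa only [add_zero, hmap] using (hmap k).symm.trans
      ((congrArg (Measure.map fun s : ℤ → H => s 0) (hX.stationary k)).trans
        (by simpa only [add_zero] using hmap 0))

end AssumptionA

end FunctionalRegression

end

theorem corollary1_general
    {Ω : Type*} [MeasurableSpace Ω] (P : Measure Ω) [IsProbabilityMeasure P]
    {H : Type*} [NormedAddCommGroup H] [InnerProductSpace ℝ H] [CompleteSpace H]
    [TopologicalSpace.SeparableSpace H] [MeasurableSpace H] [BorelSpace H] (Ψ : H →L[ℝ] H) :
    (∀ X ε : ℕ → Ω → H,
      (∀ n, 1 ≤ n → ∀ᵐ ω ∂P, X (n + 1) ω = Ψ (X n ω) + ε (n + 1) ω) →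
      FunctionalRegression.IsLpMApproximable P 4 X →
      FunctionalRegression.Orthogonal P (X 1) (ε 2) →
      ∀ m : ℕ → ℝ, Tendsto m atTop atTop →
      m =o[atTop] (fun n : ℕ => Real.sqrt n) →
      ∀ (lam : ℕ → Ω → ℕ → ℝ) (v : ℕ → Ω → ℕ → H),
      (∀ n, 1 ≤ n → ∀ ω, FunctionalRegression.IsEigensystem
        (FunctionalRegression.empiricalOperator n (fun k => X k ω) (fun k => X k ω))
        (lam n ω) (v n ω)) →
      TendstoInMeasure P
        (fun n ω => ‖Ψ (X n ω) -
          FunctionalRegression.pcEstimator n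
            (FunctionalRegression.truncationLevel n (m n) (lam n ω))
            (fun k => X k ω) (fun k => X (k + 1) ω) (lam n ω) (v n ω) (X n ω)‖)
        atTop (fun _ => (0 : ℝ))) ∧
    (Summable (fun n => ‖Ψ ^ n‖) → ∀ X ε : ℤ → Ω → H,
      (∀ k, IdentDistrib (X k) (X 0) P P) →
      (∀ k, ∀ᵐ ω ∂P, X (k + 1) ω = Ψ (X k ω) + ε (k + 1) ω) →
      iIndepFun ε P → (∀ i, IdentDistrib (ε i) (ε 0) P P) →
      (∀ i, MemLp (ε i) 4 P) → (∀ i, ∫ ω, ε i ω ∂P = 0) →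
      FunctionalRegression.AssumptionA P
        (fun k : ℕ => X k) (fun k : ℕ => ε ((k : ℤ) + 1))) := by
  have := UniformSpace.secondCountable_of_separable H
  refine ⟨fun X ε hrec hX horth m hm hmo lam v heig => ?_, fun hΨ X ε hX hrec hi hd h4 h0 =>
    FunctionalRegression.assumptionA_of_recurrence hΨ hX hrec hi hd h4 h0⟩
  have hresidual : ∫ ω, FunctionalRegression.tensor (X 1 ω) (X 2 ω - Ψ (X 1 ω)) ∂P = 0 := by
    rw [← horth.2.2]
    refine integral_congr_ae ?_
    filter_upwards [hrec 1 le_rfl] with ω hω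
    rw [hω, add_sub_cancel_left]
  simpa only [tendstoInMeasure_iff_norm, norm_norm, sub_zero, Pi.zero_apply] using
    hX.tendstoInMeasure_sub_pcEstimator_succ hresidual hm hmo
      (eventually_atTop.2 ⟨1, fun n hn => ae_of_all _ (heig n hn)⟩)

theorem corollary1
    {Ω : Type*} [MeasurableSpace Ω] (P : Measure Ω) [IsProbabilityMeasure P]
    {H : Type*} [NormedAddCommGroup H] [InnerProductSpace ℝ H] [CompleteSpace H]
    [TopologicalSpace.SeparableSpace H] [MeasurableSpace H] [BorelSpace H]
    (Ψ : H →L[ℝ] H) (hΨ : ‖Ψ‖ < 1) :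
    -- Prediction: the regression errors are `ε (k + 1)` and the responses are `X (k + 1)`, `k ≥ 1`.
    (∀ X ε : ℕ → Ω → H,
      (∀ n, 1 ≤ n → ∀ᵐ ω ∂P, X (n + 1) ω = Ψ (X n ω) + ε (n + 1) ω) →
      FunctionalRegression.AssumptionA P X (fun k => ε (k + 1)) →
      ∀ m : ℕ → ℝ, Tendsto m atTop atTop →
      m =o[atTop] (fun n : ℕ => Real.sqrt n) →
      ∀ (lam : ℕ → Ω → ℕ → ℝ) (v : ℕ → Ω → ℕ → H),
      (∀ n, 1 ≤ n → ∀ ω, FunctionalRegression.IsEigensystem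
        (FunctionalRegression.empiricalOperator n (fun k => X k ω) (fun k => X k ω))
        (lam n ω) (v n ω)) →
      TendstoInMeasure P
        (fun n ω => ‖Ψ (X n ω) -
          FunctionalRegression.pcEstimator n
            (FunctionalRegression.truncationLevel n (m n) (lam n ω))
            (fun k => X k ω) (fun k => X (k + 1) ω) (lam n ω) (v n ω) (X n ω)‖)
        atTop (fun _ => (0 : ℝ))) ∧
    -- Centred i.i.d. innovations with four moments: Assumption (A) holds.
    (∀ X ε : ℤ → Ω → H,
      FunctionalRegression.IsStationaryARH1 P Ψ X ε →
      iIndepFun ε P → (∀ i, IdentDistrib (ε i) (ε 0) P P) →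
      (∀ i, MemLp (ε i) 4 P) → (∀ i, ∫ ω, ε i ω ∂P = 0) →
      FunctionalRegression.AssumptionA P
        (fun k : ℕ => X k) (fun k : ℕ => ε ((k : ℤ) + 1))) := by
  have hsum : Summable fun n => ‖Ψ ^ n‖ :=
    (summable_geometric_of_lt_one (norm_nonneg _) hΨ).of_norm_bounded_eventually_nat (by
      simpa only [norm_norm] using eventually_norm_pow_le Ψ)
  exact (corollary1_general P Ψ).imp
    (fun hpred X ε hrec hA => hpred X ε hrec hA.approx_X (hA.orthogonal 1 le_rfl))
    fun hassume X ε hX => hassume hsum X ε hX.identDistrib hX.recurrence
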